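/- Let $\alpha>-1$ and $M>0$, let $\mathbb{D}$ be the open unit disk in $\mathbb{C}$, and let $f:\mathbb{D}\to\mathbb{C}$ be twice continuously differentiable (in the real sense) with $|f(z)|\le M$ for all $z\in\mathbb{D}$ and $T_\alpha f=0$ in $\mathbb{D}$, where $$T_\alpha f=-\frac{\alpha^2}{4}(1-|z|^2)^{-\alpha-1}f+\frac{\alpha}{2}(1-|z|^2)^{-\alpha-1}\left(z\frac{\partial f}{\partial z}+\overline{z}\frac{\partial f}{\partial\overline{z}}\right)+\frac14(1-|z|^2)^{-\alpha}\Delta f .$$ Put $$K_\alpha(z)=\frac{\Gamma(1+\alpha/2)^2}{\Gamma(1+\alpha)}\,\frac{(1-|z|^2)^{\alpha+1}}{|1-z|^{\alpha+2}}\quad(z\in\mathbb{D}),\qquad \mathcal{M}_\alpha(r)=\frac1{2\pi}\int_0^{2\pi}K_\alpha(re^{i\varepsilon})\,d\varepsilon\quad(0\le r<1).$$ Let $F(a,b;c;x)=\sum_{n\ge0}\frac{(a)_n(b)_n}{(c)_n}\frac{x^n}{n!}$ be the hypergeometric function, and let $\|D_f(z)\|$ be the operator norm of the real derivative (Jacobian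 matrix) of $f$ at $z$ with respect to the Euclidean norm, so that $\|D_f\|=|f_z|+|f_{\overline z}|$. Then $$\mathcal{M}_\alpha(r)=\frac{\Gamma(1+\alpha/2)^2}{\Gamma(1+\alpha)}\,F\!\left(-\frac\alpha2,-\frac\alpha2;1;r^2\right)\qquad\text{for all } r\in[0,1),$$ and for every $z\in\mathbb{D}$, $$\left|f(z)-\frac{(1-|z|)^{\alpha+1}}{1+|z|}f(0)\right|\le M\left[\frac1{2\pi}\int_0^{2\pi}K_\alpha(ze^{-it})\,dt-\frac{(1-|z|)^{\alpha+1}}{1+|z|}K_\alpha(0)\right]$$ and $$\|D_f(z)\|\le\frac{M\,\mathcal{M}_\alpha(|z|)\,[2+\alpha+(4+3\alpha)|z|]}{1-|z|^2}\le\frac{M\,[2+\alpha+(4+3\alpha)|z|]}{1-|z|^2}.$$ -/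

import Mathlib

noncomputable section

/-- The Wirtinger derivative `∂f/∂z = (1/2) (∂f/∂x - i ∂f/∂y)`. -/
def wirtingerDz (f : ℂ → ℂ) (z : ℂ) : ℂ :=
  (1 / 2) * (fderiv ℝ f z 1 - Complex.I * fderiv ℝ f z Complex.I)

/-- The Wirtinger derivative `∂f/∂z̄ = (1/2) (∂f/∂x + i ∂f/∂y)`. -/
def wirtingerDzbar (f : ℂ → ℂ) (z : ℂ) : ℂ :=
  (1 / 2) * (fderiv ℝ f z 1 + Complex.I * fderiv ℝ f z Complex.I)

/-- The second order elliptic operator `T_α` on the unit disk: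
`T_α f = -(α²/4) (1-|z|²)^(-α-1) f + (α/2) (1-|z|²)^(-α-1) (z f_z + z̄ f_z̄)
  + (1/4) (1-|z|²)^(-α) Δf`. -/
def opT (α : ℝ) (f : ℂ → ℂ) (z : ℂ) : ℂ :=
  ((-(α ^ 2 / 4) * (1 - ‖z‖ ^ 2) ^ (-α - 1) : ℝ) : ℂ) * f z
    + ((α / 2 * (1 - ‖z‖ ^ 2) ^ (-α - 1) : ℝ) : ℂ)
      * (z * wirtingerDz f z + (starRingEnd ℂ) z * wirtingerDzbar f z)
    + ((1 / 4 * (1 - ‖z‖ ^ 2) ^ (-α) : ℝ) : ℂ) * Laplacian.laplacian f z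

/-- The constant `c_α = Γ(1+α/2)² / Γ(1+α)`. -/
def kernelConst (α : ℝ) : ℝ :=
  Real.Gamma (1 + α / 2) ^ 2 / Real.Gamma (1 + α)

/-- The kernel `K_α(z) = c_α (1-|z|²)^(α+1) / |1-z|^(α+2)`. -/
def kernelK (α : ℝ) (z : ℂ) : ℝ :=
  kernelConst α * ((1 - ‖z‖ ^ 2) ^ (α + 1) / ‖1 - z‖ ^ (α + 2))

/-- The circular mean `𝓜_α(r) = (1/2π) ∫₀^{2π} K_α(r e^{iε}) dε`. -/
def meanK (α r : ℝ) : ℝ :=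
  (1 / (2 * Real.pi)) *
    ∫ ε in (0 : ℝ)..(2 * Real.pi), kernelK α ((r : ℂ) * Complex.exp (Complex.I * (ε : ℂ)))

end

/-!
The estimates are those of the Poisson-type representation `f = ∫ K_α(z e^{-it}) f*(e^{it}) dt / 2π`
of bounded solutions, but boundary values `f*` are never constructed.

In polar coordinates `T_α` is, up to a positive factor, the operator
`div ((1 - |z|²) ^ (-α) ∇u) - α² (1 - |z|²) ^ (-α - 1) u`. Testing against `u` on circles shows that
`∫ u(r, θ)² dθ` increases with `r`, so a solution vanishing on the circle of radius `ρ` vanishes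
inside it (`IsPolarSolution.eq_zero_of_boundary`). The kernel is a solution, and the equation is
invariant under rotations; hence, for `r ≤ ρ`,
`∫ K_α(r e^{i(φ - t)}) f(ρ e^{it}) dt = ∫ f(r e^{i(φ - t)}) K_α(ρ e^{it}) dt`,
because both sides are solutions in `r e^{iφ}` which agree for `r = ρ`
(`IsPolarSolution.conv_swap`). As `ρ → 1` the right side tends to `2π f(r e^{iφ})`, so every linear
combination of two values of `f` is bounded by `M` times the `L¹` norm of the same combination of
kernels (`norm_combination_le`). The first inequality is then Harnack's inequality for the positive
kernel, and the gradient bound is the Lipschitz constant of `log K_α`.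

Everything about the circular means comes from the substitution
`e^{iψ} = (e^{iθ} - ρ) / (1 - ρ e^{iθ})`, which turns `K_α(ρ e^{iθ}) dθ` into
`c_α |1 + ρ e^{iψ}| ^ α dψ` (`integral_polarKernel_mul`). Parseval's identity for the binomial
series of `(1 + z) ^ (α / 2)` gives the hypergeometric series, whose coefficients are nonnegative;
dominated convergence and the Beta integral for `∫ |1 + e^{iψ}| ^ α dψ = 2π / c_α` show that
`K_α(ρ e^{iθ}) dθ / 2π` is an approximate identity, and hence that the means increase to `1`.
-/

open Set Filter Topology MeasureTheory Real

/-! ### Polar solutions, angular convolution and uniqueness -/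

theorem continuousOn_intervalIntegral_of_continuousOn_prod {X : Type*} [TopologicalSpace X]
    {S : Set X} {G : X → ℝ → ℝ} (hG : ContinuousOn (Function.uncurry G) (S ×ˢ univ)) (a b : ℝ) :
    ContinuousOn (fun x => ∫ t in a..b, G x t) S := by
  rw [continuousOn_iff_continuous_domRestrict]
  have h : Continuous (Function.uncurry fun (x : S) (t : ℝ) => G x t) :=
    hG.comp_continuous (f := fun p : S × ℝ => ((p.1 : X), p.2)) (by fun_prop)
      (fun p => ⟨p.1.2, mem_univ _⟩)
  exact intervalIntegral.continuous_parametric_intervalIntegral_of_continuous' h a b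

theorem hasDerivAt_intervalIntegral_of_continuousOn {U : Set ℝ} (hU : IsOpen U) {F F' : ℝ → ℝ → ℝ}
    (hF : ContinuousOn (Function.uncurry F) (U ×ˢ univ))
    (hF' : ContinuousOn (Function.uncurry F') (U ×ˢ univ))
    (hd : ∀ x ∈ U, ∀ t, HasDerivAt (fun y => F y t) (F' x t) x) (a b : ℝ) {x : ℝ} (hx : x ∈ U) :
    HasDerivAt (fun y => ∫ t in a..b, F y t) (∫ t in a..b, F' x t) x := by
  obtain ⟨ε, hε, hεU⟩ := Metric.isOpen_iff.1 hU x hx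
  have hsub : Metric.closedBall x (ε / 2) ⊆ U :=
    (Metric.closedBall_subset_ball (by linarith)).trans hεU
  have hcF : ∀ y ∈ U, Continuous (F y) := fun y hy =>
    hF.comp_continuous (f := fun t : ℝ => (y, t)) (by fun_prop) (fun t => ⟨hy, mem_univ _⟩)
  have hcF' : ∀ y ∈ U, Continuous (F' y) := fun y hy =>
    hF'.comp_continuous (f := fun t : ℝ => (y, t)) (by fun_prop) (fun t => ⟨hy, mem_univ _⟩)
  obtain ⟨C, hC⟩ := ((isCompact_closedBall x (ε / 2)).prod
    (isCompact_uIcc (a := a) (b := b))).exists_bound_of_continuousOn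
    (hF'.mono (prod_mono hsub (subset_univ _)))
  refine (intervalIntegral.hasDerivAt_integral_of_dominated_loc_of_deriv_le
    (s := Metric.closedBall x (ε / 2)) (bound := fun _ => C)
    (Metric.closedBall_mem_nhds x (by linarith)) ?_ ?_ ?_ ?_ ?_ ?_).2
  · filter_upwards [hU.mem_nhds hx] with y hy
    exact (hcF y hy).aestronglyMeasurable
  · exact (hcF x hx).intervalIntegrable _ _
  · exact (hcF' x hx).aestronglyMeasurable
  · exact ae_of_all _ fun t ht y hy => hC (y, t) ⟨hy, uIoc_subset_uIcc ht⟩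
  · exact intervalIntegrable_const
  · exact ae_of_all _ fun t _ y hy => hd y (hsub hy) t

/-- A real `C²` solution of `T_α u = 0` on the unit disk, written in polar coordinates: `u r θ` is
the value at `r e^{iθ}`, and `ur`, `urr`, `uθ`, `uθθ` are the partial derivatives. Negative radii
are allowed, so that `r = 0` is an interior point of the interval of radii; the equation is the
polar form of `T_α u = 0` multiplied by `4 r² (1 - r²) ^ (α + 1)`. -/
structure IsPolarSolution (α : ℝ) (u ur urr uθ uθθ : ℝ → ℝ → ℝ) : Prop where
  cont : ContinuousOn (Function.uncurry u) (Ioo (-1) 1 ×ˢ univ)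
  cont_r : ContinuousOn (Function.uncurry ur) (Ioo (-1) 1 ×ˢ univ)
  cont_rr : ContinuousOn (Function.uncurry urr) (Ioo (-1) 1 ×ˢ univ)
  cont_θ : ContinuousOn (Function.uncurry uθ) (Ioo (-1) 1 ×ˢ univ)
  cont_θθ : ContinuousOn (Function.uncurry uθθ) (Ioo (-1) 1 ×ˢ univ)
  deriv_r : ∀ r ∈ Ioo (-1 : ℝ) 1, ∀ θ, HasDerivAt (fun s => u s θ) (ur r θ) r
  deriv_rr : ∀ r ∈ Ioo (-1 : ℝ) 1, ∀ θ, HasDerivAt (fun s => ur s θ) (urr r θ) r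
  deriv_θ : ∀ r ∈ Ioo (-1 : ℝ) 1, ∀ θ, HasDerivAt (u r) (uθ r θ) θ
  deriv_θθ : ∀ r ∈ Ioo (-1 : ℝ) 1, ∀ θ, HasDerivAt (uθ r) (uθθ r θ) θ
  periodic : ∀ r, Function.Periodic (u r) (2 * π)
  periodic_θ : ∀ r, Function.Periodic (uθ r) (2 * π)
  pde : ∀ r ∈ Ioo (0 : ℝ) 1, ∀ θ,
    (1 - r ^ 2) * (r ^ 2 * urr r θ + r * ur r θ + uθθ r θ) + 2 * α * r ^ 3 * ur r θ
      - α ^ 2 * r ^ 2 * u r θ = 0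

theorem continuous_slice {v : ℝ → ℝ → ℝ}
    (hv : ContinuousOn (Function.uncurry v) (Ioo (-1) 1 ×ˢ univ)) {r : ℝ}
    (hr : r ∈ Ioo (-1 : ℝ) 1) : Continuous (v r) :=
  hv.comp_continuous (f := fun t : ℝ => (r, t)) (by fun_prop) (fun _ => ⟨hr, mem_univ _⟩)

/-- The angular convolution `(r, φ) ↦ ∫₀^{2π} v(r, φ - t) h(t) dt`. -/
noncomputable def angularConv (v : ℝ → ℝ → ℝ) (h : ℝ → ℝ) (r φ : ℝ) : ℝ :=
  ∫ t in (0 : ℝ)..(2 * π), v r (φ - t) * h t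

theorem continuousOn_angularConv {v : ℝ → ℝ → ℝ} {h : ℝ → ℝ}
    (hv : ContinuousOn (Function.uncurry v) (Ioo (-1) 1 ×ˢ univ)) (hh : Continuous h) :
    ContinuousOn (Function.uncurry (angularConv v h)) (Ioo (-1) 1 ×ˢ univ) := by
  refine continuousOn_intervalIntegral_of_continuousOn_prod
    (G := fun (p : ℝ × ℝ) t => v p.1 (p.2 - t) * h t) ?_ 0 (2 * π)
  refine ContinuousOn.mul ?_ (by fun_prop)
  exact hv.comp (f := fun q : (ℝ × ℝ) × ℝ => (q.1.1, q.1.2 - q.2)) (by fun_prop)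
    (fun q hq => ⟨hq.1.1, mem_univ _⟩)

theorem hasDerivAt_angularConv_radial {v v' : ℝ → ℝ → ℝ} {h : ℝ → ℝ}
    (hv : ContinuousOn (Function.uncurry v) (Ioo (-1) 1 ×ˢ univ))
    (hv' : ContinuousOn (Function.uncurry v') (Ioo (-1) 1 ×ˢ univ)) (hh : Continuous h)
    (hd : ∀ r ∈ Ioo (-1 : ℝ) 1, ∀ θ, HasDerivAt (fun s => v s θ) (v' r θ) r)
    {r : ℝ} (hr : r ∈ Ioo (-1 : ℝ) 1) (φ : ℝ) :
    HasDerivAt (fun s => angularConv v h s φ) (angularConv v' h r φ) r := by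
  have key : ∀ {w : ℝ → ℝ → ℝ}, ContinuousOn (Function.uncurry w) (Ioo (-1) 1 ×ˢ univ) →
      ContinuousOn (Function.uncurry fun s t => w s (φ - t) * h t) (Ioo (-1) 1 ×ˢ univ) := by
    intro w hw
    refine ContinuousOn.mul ?_ (by fun_prop)
    exact hw.comp (f := fun q : ℝ × ℝ => (q.1, φ - q.2)) (by fun_prop)
      (fun q hq => ⟨hq.1, mem_univ _⟩)
  exact hasDerivAt_intervalIntegral_of_continuousOn isOpen_Ioo (key hv) (key hv')
    (fun s hs t => (hd s hs (φ - t)).mul_const (h t)) 0 (2 * π) hr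

theorem hasDerivAt_angularConv_angular {v v' : ℝ → ℝ → ℝ} {h : ℝ → ℝ}
    (hv : ContinuousOn (Function.uncurry v) (Ioo (-1) 1 ×ˢ univ))
    (hv' : ContinuousOn (Function.uncurry v') (Ioo (-1) 1 ×ˢ univ)) (hh : Continuous h)
    (hd : ∀ r ∈ Ioo (-1 : ℝ) 1, ∀ θ, HasDerivAt (v r) (v' r θ) θ)
    {r : ℝ} (hr : r ∈ Ioo (-1 : ℝ) 1) (φ : ℝ) :
    HasDerivAt (angularConv v h r) (angularConv v' h r φ) φ := by
  have key : ∀ {w : ℝ → ℝ → ℝ}, ContinuousOn (Function.uncurry w) (Ioo (-1) 1 ×ˢ univ) →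
      ContinuousOn (Function.uncurry fun s t => w r (s - t) * h t) (univ ×ˢ univ) := by
    intro w hw
    have := continuous_slice hw hr
    exact Continuous.continuousOn (by fun_prop)
  refine hasDerivAt_intervalIntegral_of_continuousOn isOpen_univ (key hv) (key hv')
    (fun s _ t => ?_) 0 (2 * π) (mem_univ φ)
  exact ((hd r hr (s - t)).comp_sub_const s t).mul_const (h t)

namespace IsPolarSolution

variable {α : ℝ} {u ur urr uθ uθθ v vr vrr vθ vθθ : ℝ → ℝ → ℝ}

/-- The equation is invariant under rotations and linear, so it is preserved by angular
convolution. -/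
theorem conv (hu : IsPolarSolution α u ur urr uθ uθθ) {h : ℝ → ℝ} (hh : Continuous h) :
    IsPolarSolution α (angularConv u h) (angularConv ur h) (angularConv urr h)
      (angularConv uθ h) (angularConv uθθ h) where
  cont := continuousOn_angularConv hu.cont hh
  cont_r := continuousOn_angularConv hu.cont_r hh
  cont_rr := continuousOn_angularConv hu.cont_rr hh
  cont_θ := continuousOn_angularConv hu.cont_θ hh
  cont_θθ := continuousOn_angularConv hu.cont_θθ hh
  deriv_r _ hr θ := hasDerivAt_angularConv_radial hu.cont hu.cont_r hh hu.deriv_r hr θ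
  deriv_rr _ hr θ := hasDerivAt_angularConv_radial hu.cont_r hu.cont_rr hh hu.deriv_rr hr θ
  deriv_θ _ hr θ := hasDerivAt_angularConv_angular hu.cont hu.cont_θ hh hu.deriv_θ hr θ
  deriv_θθ _ hr θ := hasDerivAt_angularConv_angular hu.cont_θ hu.cont_θθ hh hu.deriv_θθ hr θ
  periodic r φ := by
    simp only [angularConv]
    congr 1; ext t
    rw [show φ + 2 * π - t = φ - t + 2 * π by ring, hu.periodic r]
  periodic_θ r φ := by
    simp only [angularConv]
    congr 1; ext t
    rw [show φ + 2 * π - t = φ - t + 2 * π by ring, hu.periodic_θ r]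
  pde r hr φ := by
    have hr' : r ∈ Ioo (-1 : ℝ) 1 := ⟨by linarith [hr.1], hr.2⟩
    have hi : ∀ {w : ℝ → ℝ → ℝ}, ContinuousOn (Function.uncurry w) (Ioo (-1) 1 ×ˢ univ) →
        ∀ c : ℝ, IntervalIntegrable (fun t => c * (w r (φ - t) * h t)) volume 0 (2 * π) := by
      intro w hw c
      have := continuous_slice hw hr'
      exact Continuous.intervalIntegrable (by fun_prop) _ _
    have e : (1 - r ^ 2) * (r ^ 2 * angularConv urr h r φ + r * angularConv ur h r φ
        + angularConv uθθ h r φ) + 2 * α * r ^ 3 * angularConv ur h r φ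
        - α ^ 2 * r ^ 2 * angularConv u h r φ
        = ((1 - r ^ 2) * r ^ 2) * angularConv urr h r φ
          + ((1 - r ^ 2) * r + 2 * α * r ^ 3) * angularConv ur h r φ
          + (1 - r ^ 2) * angularConv uθθ h r φ + (- α ^ 2 * r ^ 2) * angularConv u h r φ := by
      ring
    rw [e]
    simp only [angularConv]
    simp only [← intervalIntegral.integral_const_mul]
    rw [← intervalIntegral.integral_add (hi hu.cont_rr _) (hi hu.cont_r _),
      ← intervalIntegral.integral_add ((hi hu.cont_rr _).add (hi hu.cont_r _)) (hi hu.cont_θθ _),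
      ← intervalIntegral.integral_add
        (((hi hu.cont_rr _).add (hi hu.cont_r _)).add (hi hu.cont_θθ _)) (hi hu.cont _)]
    rw [intervalIntegral.integral_congr (g := fun _ => 0), intervalIntegral.integral_zero]
    intro t _
    simp only
    linear_combination h t * hu.pde r hr (φ - t)

theorem sub (hu : IsPolarSolution α u ur urr uθ uθθ) (hv : IsPolarSolution α v vr vrr vθ vθθ) :
    IsPolarSolution α (u - v) (ur - vr) (urr - vrr) (uθ - vθ) (uθθ - vθθ) where
  cont := hu.cont.sub hv.cont
  cont_r := hu.cont_r.sub hv.cont_r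
  cont_rr := hu.cont_rr.sub hv.cont_rr
  cont_θ := hu.cont_θ.sub hv.cont_θ
  cont_θθ := hu.cont_θθ.sub hv.cont_θθ
  deriv_r r hr θ := (hu.deriv_r r hr θ).sub (hv.deriv_r r hr θ)
  deriv_rr r hr θ := (hu.deriv_rr r hr θ).sub (hv.deriv_rr r hr θ)
  deriv_θ r hr θ := (hu.deriv_θ r hr θ).sub (hv.deriv_θ r hr θ)
  deriv_θθ r hr θ := (hu.deriv_θθ r hr θ).sub (hv.deriv_θθ r hr θ)
  periodic r := (hu.periodic r).sub (hv.periodic r)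
  periodic_θ r := (hu.periodic_θ r).sub (hv.periodic_θ r)
  pde r hr θ := by
    have h1 := hu.pde r hr θ
    have h2 := hv.pde r hr θ
    simp only [Pi.sub_apply]
    linear_combination h1 - h2

theorem hasDerivAt_integral_sq (hu : IsPolarSolution α u ur urr uθ uθθ) {r : ℝ}
    (hr : r ∈ Ioo (-1 : ℝ) 1) :
    HasDerivAt (fun s => ∫ θ in (0 : ℝ)..(2 * π), u s θ ^ 2)
      (2 * ∫ θ in (0 : ℝ)..(2 * π), u r θ * ur r θ) r := by
  rw [← intervalIntegral.integral_const_mul]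
  refine hasDerivAt_intervalIntegral_of_continuousOn (U := Ioo (-1) 1) isOpen_Ioo
    (F := fun s θ => u s θ ^ 2)
    (F' := fun s θ => 2 * (u s θ * ur s θ)) (hu.cont.fun_pow 2)
    (continuousOn_const.fun_mul (hu.cont.fun_mul hu.cont_r)) (fun s hs θ => ?_) 0 (2 * π) hr
  exact ((hu.deriv_r s hs θ).fun_pow 2).congr_deriv (by push_cast; ring)

theorem hasDerivAt_integral_mul_deriv (hu : IsPolarSolution α u ur urr uθ uθθ) {r : ℝ}
    (hr : r ∈ Ioo (-1 : ℝ) 1) :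
    HasDerivAt (fun s => ∫ θ in (0 : ℝ)..(2 * π), u s θ * ur s θ)
      (∫ θ in (0 : ℝ)..(2 * π), (ur r θ * ur r θ + u r θ * urr r θ)) r :=
  hasDerivAt_intervalIntegral_of_continuousOn isOpen_Ioo (F := fun s θ => u s θ * ur s θ)
    (F' := fun s θ => ur s θ * ur s θ + u s θ * urr s θ) (hu.cont.mul hu.cont_r)
    ((hu.cont_r.mul hu.cont_r).add (hu.cont.mul hu.cont_rr))
    (fun s hs θ => (hu.deriv_r s hs θ).mul (hu.deriv_rr s hs θ)) 0 (2 * π) hr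

/-- Integration by parts over a full circle. -/
theorem integral_mul_angular (hu : IsPolarSolution α u ur urr uθ uθθ) {r : ℝ}
    (hr : r ∈ Ioo (-1 : ℝ) 1) :
    ∫ θ in (0 : ℝ)..(2 * π), u r θ * uθθ r θ = -∫ θ in (0 : ℝ)..(2 * π), uθ r θ * uθ r θ := by
  have h1 := hu.periodic r 0
  have h2 := hu.periodic_θ r 0
  rw [zero_add] at h1 h2
  rw [intervalIntegral.integral_mul_deriv_eq_deriv_mul (fun θ _ => hu.deriv_θ r hr θ)
    (fun θ _ => hu.deriv_θθ r hr θ) ((continuous_slice hu.cont_θ hr).intervalIntegrable _ _)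
    ((continuous_slice hu.cont_θθ hr).intervalIntegrable _ _), h1, h2]
  ring

/-- The energy identity: the flux `∫ u u_r dθ` satisfies a first order linear differential
inequality, because the equation turns `u · div ((1 - |z|²) ^ (-α) ∇u)` into a nonnegative
multiple of `u²`. -/
theorem energy_nonneg (hu : IsPolarSolution α u ur urr uθ uθθ) {r : ℝ} (hr : r ∈ Ioo (0 : ℝ) 1) :
    0 ≤ ((1 - r ^ 2) * r + 2 * α * r ^ 3) * (∫ θ in (0 : ℝ)..(2 * π), u r θ * ur r θ)
      + (1 - r ^ 2) * r ^ 2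
        * ∫ θ in (0 : ℝ)..(2 * π), (ur r θ * ur r θ + u r θ * urr r θ) := by
  have hr' : r ∈ Ioo (-1 : ℝ) 1 := ⟨by linarith [hr.1], hr.2⟩
  have c0 := continuous_slice hu.cont hr'
  have c1 := continuous_slice hu.cont_r hr'
  have c2 := continuous_slice hu.cont_rr hr'
  have c3 := continuous_slice hu.cont_θ hr'
  have c4 := continuous_slice hu.cont_θθ hr'
  have hw : 0 ≤ 1 - r ^ 2 := by nlinarith [hr.1, hr.2]
  have hpi := Real.two_pi_pos.le
  have e : ((1 - r ^ 2) * r + 2 * α * r ^ 3) * (∫ θ in (0 : ℝ)..(2 * π), u r θ * ur r θ)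
      + (1 - r ^ 2) * r ^ 2 * (∫ θ in (0 : ℝ)..(2 * π), (ur r θ * ur r θ + u r θ * urr r θ))
      = (∫ θ in (0 : ℝ)..(2 * π), (α ^ 2 * r ^ 2 * u r θ ^ 2 + (1 - r ^ 2) * r ^ 2 * ur r θ ^ 2))
        + (1 - r ^ 2) * ∫ θ in (0 : ℝ)..(2 * π), uθ r θ * uθ r θ := by
    have := hu.integral_mul_angular hr'
    rw [show (∫ θ in (0 : ℝ)..(2 * π), uθ r θ * uθ r θ)
      = -∫ θ in (0 : ℝ)..(2 * π), u r θ * uθθ r θ by rw [this, neg_neg], mul_neg,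
      ← sub_eq_add_neg]
    simp only [← intervalIntegral.integral_const_mul]
    rw [← intervalIntegral.integral_add (Continuous.intervalIntegrable (by fun_prop) _ _)
      (Continuous.intervalIntegrable (by fun_prop) _ _),
      ← intervalIntegral.integral_sub (Continuous.intervalIntegrable (by fun_prop) _ _)
      (Continuous.intervalIntegrable (by fun_prop) _ _)]
    refine intervalIntegral.integral_congr fun θ _ => ?_
    linear_combination u r θ * hu.pde r hr θ
  rw [e]
  refine add_nonneg (intervalIntegral.integral_nonneg hpi fun θ _ => by positivity)
    (mul_nonneg hw (intervalIntegral.integral_nonneg hpi fun θ _ => mul_self_nonneg _))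

theorem flux_nonneg (hu : IsPolarSolution α u ur urr uθ uθθ) {r : ℝ} (hr : r ∈ Ioo (0 : ℝ) 1) :
    0 ≤ ∫ θ in (0 : ℝ)..(2 * π), u r θ * ur r θ := by
  set P : ℝ → ℝ := fun s => ∫ θ in (0 : ℝ)..(2 * π), u s θ * ur s θ with hP
  set P' : ℝ → ℝ := fun s => ∫ θ in (0 : ℝ)..(2 * π), (ur s θ * ur s θ + u s θ * urr s θ) with hP'
  have hPd : ∀ s ∈ Ioo (-1 : ℝ) 1, HasDerivAt P (P' s) s := fun s hs =>
    hu.hasDerivAt_integral_mul_deriv hs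
  have hwd : ∀ s ∈ Ioo (-1 : ℝ) 1, HasDerivAt (fun s : ℝ => (1 - s ^ 2) ^ (-α))
      (2 * α * s * (1 - s ^ 2) ^ (-α - 1)) s := by
    intro s hs
    have hw : 0 < 1 - s ^ 2 := by nlinarith [hs.1, hs.2]
    have h1 : HasDerivAt (fun s : ℝ => 1 - s ^ 2) (-(2 * s)) s := by
      simpa using (hasDerivAt_pow 2 s).const_sub 1
    convert h1.rpow_const (p := -α) (Or.inl hw.ne') using 1
    ring
  -- `r (1 - r²) ^ (-α)` is the integrating factor of the energy inequality.
  have hQd : ∀ s ∈ Ioo (-1 : ℝ) 1, HasDerivAt (fun s => s * (1 - s ^ 2) ^ (-α) * P s)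
      ((1 * (1 - s ^ 2) ^ (-α) + s * (2 * α * s * (1 - s ^ 2) ^ (-α - 1))) * P s
        + s * (1 - s ^ 2) ^ (-α) * P' s) s := fun s hs =>
    ((hasDerivAt_id s).mul (hwd s hs)).mul (hPd s hs)
  have hmono : MonotoneOn (fun s => s * (1 - s ^ 2) ^ (-α) * P s) (Icc 0 r) := by
    have hsub : Icc 0 r ⊆ Ioo (-1 : ℝ) 1 := fun s hs =>
      ⟨by linarith [hs.1], by linarith [hs.2, hr.2]⟩
    refine monotoneOn_of_deriv_nonneg (convex_Icc 0 r)
      (fun s hs => (hQd s (hsub hs)).continuousAt.continuousWithinAt)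
      (fun s hs => (hQd s (hsub (interior_subset hs))).differentiableAt.differentiableWithinAt)
      (fun s hs => ?_)
    rw [interior_Icc] at hs
    have hs' : s ∈ Ioo (0 : ℝ) 1 := ⟨hs.1, hs.2.trans hr.2⟩
    have hw : 0 < 1 - s ^ 2 := by nlinarith [hs'.1, hs'.2]
    rw [(hQd s (hsub (Ioo_subset_Icc_self hs))).deriv]
    have hen := hu.energy_nonneg hs'
    change 0 ≤ _ * P s + _ * P' s at hen
    have hpow : (1 - s ^ 2) ^ (-α) = (1 - s ^ 2) ^ (-α - 1) * (1 - s ^ 2) := by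
      rw [← rpow_add_one hw.ne']; congr 1; ring
    have hpos : 0 < (1 - s ^ 2) ^ (-α - 1) := rpow_pos_of_pos hw _
    have : 0 ≤ (1 - s ^ 2) ^ (-α - 1) / s * (((1 - s ^ 2) * s + 2 * α * s ^ 3) * P s
      + (1 - s ^ 2) * s ^ 2 * P' s) := mul_nonneg (div_pos hpos hs.1).le hen
    convert this using 1
    rw [hpow]
    have := hs.1.ne'
    field_simp
  have h := hmono (left_mem_Icc.2 hr.1.le) (right_mem_Icc.2 hr.1.le) hr.1.le
  simp only [zero_mul] at h
  have hw : 0 < 1 - r ^ 2 := by nlinarith [hr.1, hr.2]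
  exact nonneg_of_mul_nonneg_right h (mul_pos hr.1 (rpow_pos_of_pos hw _))

/-- Uniqueness for the Dirichlet problem on a disk of radius `ρ < 1`: the means
`∫ u(r, θ)² dθ` increase with `r`. -/
theorem eq_zero_of_boundary (hu : IsPolarSolution α u ur urr uθ uθθ) {r ρ : ℝ}
    (hr0 : 0 ≤ r) (hr : r ≤ ρ) (hρ : ρ < 1) (h0 : ∀ θ, u ρ θ = 0) (θ : ℝ) : u r θ = 0 := by
  have hsub : Icc 0 ρ ⊆ Ioo (-1 : ℝ) 1 := fun s hs =>
    ⟨by linarith [hs.1], by linarith [hs.2]⟩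
  have hmono : MonotoneOn (fun s => ∫ θ in (0 : ℝ)..(2 * π), u s θ ^ 2) (Icc 0 ρ) := by
    refine monotoneOn_of_deriv_nonneg (convex_Icc 0 ρ)
      (fun s hs => (hu.hasDerivAt_integral_sq (hsub hs)).continuousAt.continuousWithinAt)
      (fun s hs => (hu.hasDerivAt_integral_sq
        (hsub (interior_subset hs))).differentiableAt.differentiableWithinAt) (fun s hs => ?_)
    rw [(hu.hasDerivAt_integral_sq (hsub (interior_subset hs))).deriv]
    rw [interior_Icc] at hs
    have := hu.flux_nonneg (r := s) ⟨hs.1, hs.2.trans hρ⟩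
    positivity
  have hrm : r ∈ Icc 0 ρ := ⟨hr0, hr⟩
  have hle := hmono hrm (right_mem_Icc.2 (hr0.trans hr)) hr
  simp only [h0, ne_eq, OfNat.ofNat_ne_zero, not_false_eq_true, zero_pow,
    intervalIntegral.integral_zero] at hle
  have hc := continuous_slice hu.cont (hsub hrm)
  -- A positive value of `u²` anywhere on the circle would make its integral positive.
  by_contra hne
  obtain ⟨θ₀, hθ₀, hval⟩ := (hu.periodic r).exists_mem_Ico₀ Real.two_pi_pos θ
  have hpos : 0 < ∫ θ in (0 : ℝ)..(2 * π), u r θ ^ 2 := by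
    refine intervalIntegral.integral_pos Real.two_pi_pos (by fun_prop)
      (fun _ _ => sq_nonneg _) ⟨θ₀, ⟨hθ₀.1, hθ₀.2.le⟩, ?_⟩
    rw [← hval]; positivity
  linarith

end IsPolarSolution

/-- Two solutions may exchange the radii at which they enter an angular convolution: as functions
of the smaller radius both sides are solutions, and they agree when the two radii are equal. -/
theorem IsPolarSolution.conv_swap {α : ℝ} {u ur urr uθ uθθ v vr vrr vθ vθθ : ℝ → ℝ → ℝ}
    (hu : IsPolarSolution α u ur urr uθ uθθ) (hv : IsPolarSolution α v vr vrr vθ vθθ) {r ρ : ℝ}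
    (hr0 : 0 ≤ r) (hr : r ≤ ρ) (hρ : ρ < 1) (φ : ℝ) :
    angularConv u (v ρ) r φ = angularConv v (u ρ) r φ := by
  have hρ' : ρ ∈ Ioo (-1 : ℝ) 1 := ⟨by linarith, hρ⟩
  refine sub_eq_zero.1 (((hu.conv (continuous_slice hv.cont hρ')).sub
    (hv.conv (continuous_slice hu.cont hρ'))).eq_zero_of_boundary hr0 hr hρ (fun θ => ?_) φ)
  simp only [Pi.sub_apply, sub_eq_zero, angularConv]
  have hper : Function.Periodic (fun t => u ρ t * v ρ (θ - t)) (2 * π) := by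
    intro t
    simp only [hu.periodic ρ t]
    rw [show θ - (t + 2 * π) = θ - t - 2 * π by ring, (hv.periodic ρ).sub_eq]
  calc ∫ t in (0 : ℝ)..(2 * π), u ρ (θ - t) * v ρ t
      = ∫ t in (0 : ℝ)..(2 * π), (fun t => u ρ t * v ρ (θ - t)) (θ - t) := by
        simp only [sub_sub_cancel]
    _ = ∫ t in (θ - 2 * π)..θ, u ρ t * v ρ (θ - t) := by
        rw [intervalIntegral.integral_comp_sub_left (fun t => u ρ t * v ρ (θ - t)), sub_zero]
    _ = ∫ t in (0 : ℝ)..(2 * π), v ρ (θ - t) * u ρ t := by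
        have := hper.intervalIntegral_add_eq (θ - 2 * π) 0
        simp only [sub_add_cancel, zero_add] at this
        rw [this]
        simp only [mul_comm]

/-! ### The kernel as an approximate identity -/

theorem integral_rpow_mul_one_sub_rpow {s : ℝ} (hs : 0 < s) :
    ∫ x in Ioo (0 : ℝ) 1, x ^ (s - 1) * (1 - x) ^ (s - 1) = ProbabilityTheory.beta s s := by
  rw [ProbabilityTheory.beta_eq_betaIntegralReal s s hs hs, Complex.betaIntegral,
    intervalIntegral.integral_of_le (by norm_num), ← integral_Ioc_eq_integral_Ioo,
    ← RCLike.re_to_complex, ← integral_re]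
  · refine setIntegral_congr_fun measurableSet_Ioc fun x ⟨hx1, hx2⟩ => ?_
    norm_cast
    rw [← Complex.ofReal_cpow, ← Complex.ofReal_cpow, RCLike.re_to_complex,
      Complex.re_mul_ofReal, Complex.ofReal_re]
    all_goals linarith
  · have h := Complex.betaIntegral_convergent (u := s) (v := s) (by simpa) (by simpa)
    rwa [intervalIntegrable_iff_integrableOn_Ioc_of_le (by simp)] at h

theorem image_one_add_sin_half :
    (fun ψ : ℝ => (1 + sin (ψ / 2)) / 2) '' Ioo (-π) π = Ioo 0 1 := by
  ext y
  constructor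
  · rintro ⟨ψ, ⟨h1, h2⟩, rfl⟩
    have h3 : sin (ψ / 2) < 1 := by
      rw [← sin_pi_div_two]
      exact sin_lt_sin_of_lt_of_le_pi_div_two (by linarith) le_rfl (by linarith)
    have h4 : -1 < sin (ψ / 2) := by
      rw [← sin_pi_div_two, ← sin_neg]
      exact sin_lt_sin_of_lt_of_le_pi_div_two (by linarith) (by linarith) (by linarith)
    constructor <;> simp only <;> linarith
  · rintro ⟨h1, h2⟩
    have h3 : -(π / 2) < arcsin (2 * y - 1) := neg_pi_div_two_lt_arcsin.2 (by linarith)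
    have h4 : arcsin (2 * y - 1) < π / 2 := arcsin_lt_pi_div_two.2 (by linarith)
    refine ⟨2 * arcsin (2 * y - 1), ⟨by linarith, by linarith⟩, ?_⟩
    simp only
    rw [mul_div_cancel_left₀ _ two_ne_zero, sin_arcsin (by linarith) (by linarith)]
    ring

theorem kernelConst_pos {α : ℝ} (hα : -1 < α) : 0 < kernelConst α :=
  div_pos (pow_pos (Gamma_pos_of_pos (by linarith)) 2) (Gamma_pos_of_pos (by linarith))

/-- The substitution `x = (1 + sin (ψ / 2)) / 2` turns this integral into the Beta integral
`B(s, s)` with `s = (α + 1) / 2`, and Legendre's duplication formula evaluates it. -/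
theorem integral_two_mul_cos_half_rpow {α : ℝ} (hα : -1 < α) :
    ∫ ψ in Ioo (-π) π, (2 * cos (ψ / 2)) ^ α = 2 * π / kernelConst α := by
  have hcos : ∀ ψ ∈ Ioo (-π) π, 0 < cos (ψ / 2) := fun ψ hψ =>
    cos_pos_of_mem_Ioo ⟨by linarith [hψ.1], by linarith [hψ.2]⟩
  set s : ℝ := (α + 1) / 2 with hs
  have hs0 : 0 < s := by rw [hs]; linarith
  have hd : ∀ ψ ∈ Ioo (-π) π, HasDerivWithinAt (fun ψ : ℝ => (1 + sin (ψ / 2)) / 2)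
      (cos (ψ / 2) / 4) (Ioo (-π) π) ψ := by
    intro ψ _
    have h := (((hasDerivAt_id ψ).div_const 2).sin.const_add 1).div_const 2
    refine (h.congr_deriv ?_).hasDerivWithinAt
    simp only [id]; ring
  have hinj : InjOn (fun ψ : ℝ => (1 + sin (ψ / 2)) / 2) (Ioo (-π) π) := by
    intro x hx y hy hxy
    have h : sin (x / 2) = sin (y / 2) := by simp only at hxy; linarith
    have := injOn_sin ⟨by linarith [hx.1], by linarith [hx.2]⟩
      ⟨by linarith [hy.1], by linarith [hy.2]⟩ h
    linarith
  have key := integral_image_eq_integral_abs_deriv_smul measurableSet_Ioo hd hinj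
    (fun x : ℝ => x ^ (s - 1) * (1 - x) ^ (s - 1))
  rw [image_one_add_sin_half, integral_rpow_mul_one_sub_rpow hs0] at key
  have hcongr : ∫ ψ in Ioo (-π) π, (2 * cos (ψ / 2)) ^ α
      = ∫ ψ in Ioo (-π) π, (2 * 4 ^ α) * (|cos (ψ / 2) / 4| • (((1 + sin (ψ / 2)) / 2) ^ (s - 1)
        * (1 - (1 + sin (ψ / 2)) / 2) ^ (s - 1))) := by
    refine setIntegral_congr_fun measurableSet_Ioo fun ψ hψ => ?_
    have hc := hcos ψ hψ
    have h1 : -1 ≤ sin (ψ / 2) := neg_one_le_sin _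
    have h2 : sin (ψ / 2) ≤ 1 := sin_le_one _
    have hsq : (1 + sin (ψ / 2)) / 2 * (1 - (1 + sin (ψ / 2)) / 2)
        = (cos (ψ / 2) / 2) ^ (2 : ℝ) := by
      rw [rpow_two]
      have := sin_sq_add_cos_sq (ψ / 2)
      linear_combination -(1 / 4 : ℝ) * this
    rw [← mul_rpow (by linarith) (by linarith), hsq, ← rpow_mul (by positivity),
      abs_of_pos (by positivity), smul_eq_mul, show 2 * (s - 1) = α - 1 by rw [hs]; ring,
      show 2 * cos (ψ / 2) = 4 * (cos (ψ / 2) / 2) by ring, mul_rpow (by norm_num) (by positivity),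
      show (cos (ψ / 2) / 2) ^ α = (cos (ψ / 2) / 2) ^ (α - 1) * (cos (ψ / 2) / 2) by
        rw [← rpow_add_one (by positivity)]; congr 1; ring]
    ring
  rw [hcongr, integral_const_mul, ← key, ProbabilityTheory.beta, kernelConst]
  have hdup := Gamma_mul_Gamma_add_half s
  rw [show s + 1 / 2 = 1 + α / 2 by rw [hs]; ring, show 2 * s = 1 + α by rw [hs]; ring] at hdup
  rw [← two_mul, show 2 * s = 1 + α by rw [hs]; ring]
  have g1 : 0 < Gamma (1 + α / 2) := Gamma_pos_of_pos (by linarith)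
  have g2 : 0 < Gamma (1 + α) := Gamma_pos_of_pos (by linarith)
  have h4 : (4 : ℝ) ^ α * (2 ^ (1 - (1 + α))) ^ 2 = 1 := by
    rw [← rpow_natCast, ← rpow_mul (by norm_num), show (4 : ℝ) = 2 ^ (2 : ℝ) by norm_num,
      ← rpow_mul (by norm_num), ← rpow_add (by norm_num)]
    rw [show 2 * α + (1 - (1 + α)) * ((2 : ℕ) : ℝ) = 0 by push_cast; ring, rpow_zero]
  have hpi : √π ^ 2 = π := sq_sqrt pi_pos.le
  have main : 4 ^ α * Gamma s ^ 2 * Gamma (1 + α / 2) ^ 2 = π * Gamma (1 + α) ^ 2 := calc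
    _ = 4 ^ α * (Gamma s * Gamma (1 + α / 2)) ^ 2 := by ring
    _ = (4 ^ α * (2 ^ (1 - (1 + α))) ^ 2) * Gamma (1 + α) ^ 2 * √π ^ 2 := by rw [hdup]; ring
    _ = _ := by rw [h4, hpi]; ring
  rw [div_div_eq_mul_div, eq_div_iff (by positivity)]
  calc _ = 2 * (4 ^ α * Gamma s ^ 2 * Gamma (1 + α / 2) ^ 2) / Gamma (1 + α) := by ring
    _ = _ := by rw [main]; field_simp

theorem integrableOn_two_mul_cos_half_rpow {α : ℝ} (hα : -1 < α) :
    IntegrableOn (fun ψ => (2 * cos (ψ / 2)) ^ α) (Ioo (-π) π) := by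
  by_contra h
  have h1 := integral_two_mul_cos_half_rpow hα
  rw [integral_undef h] at h1
  have := div_pos two_pi_pos (kernelConst_pos hα)
  linarith

/-- The kernel `K_α` in polar coordinates, with `‖1 - r e^{iθ}‖² = 1 - 2 r cos θ + r²`. -/
noncomputable def polarKernel (α r θ : ℝ) : ℝ :=
  kernelConst α * ((1 - r ^ 2) ^ (α + 1) * (1 - 2 * r * cos θ + r ^ 2) ^ (-(α / 2 + 1)))

theorem one_sub_two_mul_cos_add_sq_pos {r : ℝ} (hr : r ∈ Ioo (-1 : ℝ) 1) (θ : ℝ) :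
    0 < 1 - 2 * r * cos θ + r ^ 2 := by
  have h1 := neg_one_le_cos θ
  have h2 := cos_le_one θ
  rcases le_total 0 r with h | h
  · nlinarith [hr.1, hr.2, mul_nonneg h (sub_nonneg.2 h2), sq_pos_of_pos (sub_pos.2 hr.2)]
  · nlinarith [hr.1, hr.2, mul_nonneg (neg_nonneg.2 h) (neg_le_iff_add_nonneg.1 h1),
      sq_pos_of_pos (neg_lt_iff_pos_add.1 hr.1)]

theorem exp_I_mul_ofReal (θ : ℝ) :
    Complex.exp (Complex.I * θ) = (cos θ : ℂ) + (sin θ : ℂ) * Complex.I := by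
  rw [mul_comm, Complex.exp_mul_I, Complex.ofReal_cos, Complex.ofReal_sin]

theorem norm_add_mul_exp_sq (r θ : ℝ) :
    ‖1 + (r : ℂ) * Complex.exp (Complex.I * θ)‖ ^ 2 = 1 + 2 * r * cos θ + r ^ 2 := by
  have e : 1 + (r : ℂ) * Complex.exp (Complex.I * θ)
      = ((1 + r * cos θ : ℝ) : ℂ) + ((r * sin θ : ℝ) : ℂ) * Complex.I := by
    rw [exp_I_mul_ofReal]; push_cast; ring
  rw [e, ← Complex.normSq_eq_norm_sq, Complex.normSq_add_mul_I]
  linear_combination r ^ 2 * sin_sq_add_cos_sq θ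

theorem kernelK_ofReal_mul_exp (α r θ : ℝ) :
    kernelK α (r * Complex.exp (Complex.I * θ)) = polarKernel α r θ := by
  have h1 : ‖(r : ℂ) * Complex.exp (Complex.I * θ)‖ ^ 2 = r ^ 2 := by
    rw [norm_mul, mul_comm Complex.I, Complex.norm_exp_ofReal_mul_I]; simp
  have h2 : ‖1 - (r : ℂ) * Complex.exp (Complex.I * θ)‖ ^ 2 = 1 - 2 * r * cos θ + r ^ 2 := by
    have := norm_add_mul_exp_sq (-r) θ
    push_cast at this
    rw [sub_eq_add_neg, ← neg_mul, this]; ring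
  have h3 : (1 - 2 * r * cos θ + r ^ 2) ^ (-(α / 2 + 1))
      = ‖1 - (r : ℂ) * Complex.exp (Complex.I * θ)‖ ^ (-(α + 2)) := by
    rw [← h2, ← rpow_natCast, ← rpow_mul (norm_nonneg _)]
    congr 1; push_cast; ring
  rw [kernelK, polarKernel, h1, h3, div_eq_mul_inv, ← rpow_neg (norm_nonneg _)]

/-- The argument of `(e^{iθ} - ρ) / (1 - ρ e^{iθ})`, for `|ρ| < 1`. -/
noncomputable def moebiusAngle (ρ θ : ℝ) : ℝ :=
  θ + 2 * arctan (ρ * sin θ / (1 - ρ * cos θ))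

theorem one_sub_mul_cos_pos {ρ : ℝ} (h0 : 0 ≤ ρ) (h1 : ρ < 1) (θ : ℝ) : 0 < 1 - ρ * cos θ := by
  nlinarith [cos_le_one θ]

theorem hasDerivAt_moebiusAngle {ρ : ℝ} (h0 : 0 ≤ ρ) (h1 : ρ < 1) (θ : ℝ) :
    HasDerivAt (moebiusAngle ρ) ((1 - ρ ^ 2) / (1 - 2 * ρ * cos θ + ρ ^ 2)) θ := by
  have hx := one_sub_mul_cos_pos h0 h1 θ
  have hQ := one_sub_two_mul_cos_add_sq_pos (r := ρ) ⟨by linarith, h1⟩ θ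
  have h := (hasDerivAt_id θ).add (((((hasDerivAt_sin θ).const_mul ρ).div
    (((hasDerivAt_cos θ).const_mul ρ).const_sub 1) hx.ne').arctan).const_mul 2)
  refine h.congr_deriv ?_
  have e : 1 + (ρ * sin θ / (1 - ρ * cos θ)) ^ 2
      = (1 - 2 * ρ * cos θ + ρ ^ 2) / (1 - ρ * cos θ) ^ 2 := by
    field_simp
    linear_combination ρ ^ 2 * sin_sq_add_cos_sq θ
  simp only [Pi.div_apply]
  rw [e]
  field_simp
  linear_combination (-2 * ρ ^ 2) * sin_sq_add_cos_sq θ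

theorem exp_moebiusAngle {ρ : ℝ} (h0 : 0 ≤ ρ) (h1 : ρ < 1) (θ : ℝ) :
    Complex.exp (Complex.I * moebiusAngle ρ θ) * (1 - ρ * Complex.exp (Complex.I * θ))
      = Complex.exp (Complex.I * θ) - ρ := by
  have hx := one_sub_mul_cos_pos h0 h1 θ
  set t := ρ * sin θ / (1 - ρ * cos θ) with ht
  have htx : t * (1 - ρ * cos θ) = ρ * sin θ := div_mul_cancel₀ _ hx.ne'
  have hc := cos_arctan_pos t
  have hsin : sin (arctan t) = t * cos (arctan t) := by
    rw [← tan_mul_cos hc.ne', tan_arctan]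
  have hc2 : cos (arctan t) ^ 2 * (1 + t ^ 2) = 1 := by
    rw [cos_sq_arctan]; field_simp
  have hc2' : (cos (arctan t) : ℂ) ^ 2 * (1 + (t : ℂ) ^ 2) = 1 := by exact_mod_cast hc2
  have htx' : (t : ℂ) * (1 - ρ * (cos θ : ℂ)) = ρ * (sin θ : ℂ) := by exact_mod_cast htx
  have hcs : (sin θ : ℂ) ^ 2 + (cos θ : ℂ) ^ 2 = 1 := by exact_mod_cast sin_sq_add_cos_sq θ
  rw [moebiusAngle, ← ht]
  have e : Complex.exp (Complex.I * ((θ + 2 * arctan t : ℝ) : ℂ))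
      = Complex.exp (Complex.I * θ) * Complex.exp (Complex.I * (arctan t : ℝ)) ^ 2 := by
    rw [← Complex.exp_nat_mul, ← Complex.exp_add]
    congr 1; push_cast; ring
  rw [e, exp_I_mul_ofReal θ, exp_I_mul_ofReal (arctan t), hsin]
  push_cast only [Complex.ofReal_mul]
  generalize (cos (arctan t) : ℂ) = c at *
  generalize (cos θ : ℂ) = a at *
  generalize (sin θ : ℂ) = b at *
  have e1 : 1 - (ρ : ℂ) * (a + b * Complex.I) = (1 - ρ * a) * (1 - t * Complex.I) := by
    linear_combination Complex.I * htx'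
  have e2 : a + b * Complex.I - ρ = (a + b * Complex.I) * ((1 - ρ * a) * (1 + t * Complex.I)) := by
    linear_combination (-(a + b * Complex.I) * Complex.I) * htx' + (ρ : ℂ) * hcs
      - (ρ : ℂ) * b ^ 2 * Complex.I_sq
  rw [e1, e2]
  linear_combination (a + b * Complex.I) * (1 - ρ * a) * (1 + t * Complex.I) * hc2'
    - (a + b * Complex.I) * (1 - ρ * a) * (1 + t * Complex.I) * c ^ 2 * t ^ 2 * Complex.I_sq

theorem one_add_mul_exp_ne_zero {ρ : ℝ} (h0 : 0 ≤ ρ) (h1 : ρ < 1) (θ : ℝ) :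
    1 + (ρ : ℂ) * Complex.exp (Complex.I * θ) ≠ 0 := by
  intro h
  have h2 := norm_add_mul_exp_sq ρ θ
  rw [h, norm_zero] at h2
  have := one_sub_two_mul_cos_add_sq_pos (r := -ρ) ⟨by linarith, by linarith⟩ θ
  linarith

theorem one_add_mul_exp_moebiusAngle {ρ : ℝ} (h0 : 0 ≤ ρ) (h1 : ρ < 1) (θ : ℝ) :
    (1 + ρ * Complex.exp (Complex.I * moebiusAngle ρ θ))
      * (1 - ρ * Complex.exp (Complex.I * θ)) = ((1 - ρ ^ 2 : ℝ) : ℂ) := by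
  push_cast
  linear_combination (ρ : ℂ) * exp_moebiusAngle h0 h1 θ

/-- The disk automorphism `ζ ↦ (ζ + ρ) / (1 + ρ ζ)` at `ζ = e^{iψ}`. -/
noncomputable def moebiusPoint (ρ ψ : ℝ) : ℂ :=
  (Complex.exp (Complex.I * ψ) + ρ) / (1 + ρ * Complex.exp (Complex.I * ψ))

theorem moebiusPoint_moebiusAngle {ρ : ℝ} (h0 : 0 ≤ ρ) (h1 : ρ < 1) (θ : ℝ) :
    moebiusPoint ρ (moebiusAngle ρ θ) = Complex.exp (Complex.I * θ) := by
  rw [moebiusPoint, div_eq_iff (one_add_mul_exp_ne_zero h0 h1 _)]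
  linear_combination exp_moebiusAngle h0 h1 θ

theorem norm_moebiusPoint_le_one (ρ ψ : ℝ) : ‖moebiusPoint ρ ψ‖ ≤ 1 := by
  have h : ‖Complex.exp (Complex.I * ψ) + ρ‖ = ‖1 + (ρ : ℂ) * Complex.exp (Complex.I * ψ)‖ := by
    have e : Complex.exp (Complex.I * ψ) + ρ
        = Complex.exp (Complex.I * ψ) * (1 + ρ * Complex.exp (Complex.I * (-ψ : ℝ))) := by
      have : Complex.exp (Complex.I * ψ) * Complex.exp (Complex.I * (-ψ : ℝ)) = 1 := by
        rw [← Complex.exp_add]; simp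
      linear_combination -(ρ : ℂ) * this
    rw [e, norm_mul, mul_comm Complex.I (ψ : ℂ), Complex.norm_exp_ofReal_mul_I, one_mul,
      ← sq_eq_sq₀ (norm_nonneg _) (norm_nonneg _), norm_add_mul_exp_sq, mul_comm (ψ : ℂ),
      norm_add_mul_exp_sq, cos_neg]
  rw [moebiusPoint, norm_div, h]
  exact div_self_le_one _

/-- The kernel integral after the Möbius substitution: the factor
`(1 - ρ²) / ‖1 - ρ e^{it}‖²` of the kernel is the Jacobian, and the remaining factor of `K_α` is
the power `α` of `‖1 + ρ e^{iψ}‖ = (1 - ρ²) / ‖1 - ρ e^{it}‖`. -/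
theorem integral_polarKernel_mul {H : ℂ → ℝ} (hH : ContinuousOn H (Metric.closedBall 0 1))
    (α : ℝ) {ρ : ℝ} (h0 : 0 ≤ ρ) (h1 : ρ < 1) :
    ∫ t in (-π)..π, polarKernel α ρ t * H (Complex.exp (Complex.I * t))
      = kernelConst α * ∫ ψ in (-π)..π, ‖1 + (ρ : ℂ) * Complex.exp (Complex.I * ψ)‖ ^ α
        * H (moebiusPoint ρ ψ) := by
  have hw : 0 < 1 - ρ ^ 2 := by nlinarith
  set G : ℝ → ℝ := fun ψ => ‖1 + (ρ : ℂ) * Complex.exp (Complex.I * ψ)‖ ^ α * H (moebiusPoint ρ ψ)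
    with hG
  have hGc : Continuous G := by
    refine Continuous.mul (Continuous.rpow_const (by fun_prop) fun ψ => Or.inl ?_) ?_
    · exact norm_ne_zero_iff.2 (one_add_mul_exp_ne_zero h0 h1 ψ)
    · refine hH.comp_continuous ?_ fun ψ => by simpa using norm_moebiusPoint_le_one ρ ψ
      unfold moebiusPoint
      exact Continuous.div (by fun_prop) (by fun_prop) fun ψ => one_add_mul_exp_ne_zero h0 h1 ψ
  have hJc : Continuous fun θ => (1 - ρ ^ 2) / (1 - 2 * ρ * cos θ + ρ ^ 2) :=
    Continuous.div (by fun_prop) (by fun_prop) fun θ =>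
      (one_sub_two_mul_cos_add_sq_pos (r := ρ) ⟨by linarith, h1⟩ θ).ne'
  have key := intervalIntegral.integral_comp_mul_deriv (a := -π) (b := π)
    (fun θ _ => hasDerivAt_moebiusAngle h0 h1 θ) hJc.continuousOn hGc
  have ha : moebiusAngle ρ (-π) = -π := by simp [moebiusAngle]
  have hb : moebiusAngle ρ π = π := by simp [moebiusAngle]
  rw [ha, hb] at key
  rw [← key, ← intervalIntegral.integral_const_mul]
  refine intervalIntegral.integral_congr fun θ _ => ?_
  have hQ := one_sub_two_mul_cos_add_sq_pos (r := ρ) ⟨by linarith, h1⟩ θ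
  simp only [Function.comp, hG, moebiusPoint_moebiusAngle h0 h1, polarKernel]
  have hn : ‖1 + (ρ : ℂ) * Complex.exp (Complex.I * moebiusAngle ρ θ)‖
      = (1 - ρ ^ 2) * (1 - 2 * ρ * cos θ + ρ ^ 2) ^ (-(1 / 2) : ℝ) := by
    have e := congrArg norm (one_add_mul_exp_moebiusAngle h0 h1 θ)
    rw [norm_mul, Complex.norm_real, norm_of_nonneg hw.le] at e
    have h2 := norm_add_mul_exp_sq (-ρ) θ
    push_cast at h2
    rw [neg_mul, ← sub_eq_add_neg] at h2
    have h3 : ‖1 - (ρ : ℂ) * Complex.exp (Complex.I * θ)‖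
        = (1 - 2 * ρ * cos θ + ρ ^ 2) ^ (1 / 2 : ℝ) := by
      rw [← sqrt_eq_rpow, ← sqrt_sq (norm_nonneg _), h2]; congr 1; ring
    rw [h3] at e
    rw [rpow_neg hQ.le, ← div_eq_mul_inv, eq_div_iff (rpow_pos_of_pos hQ _).ne', e]
  rw [hn, mul_rpow hw.le (rpow_pos_of_pos hQ _).le, ← rpow_mul hQ.le, rpow_add_one hw.ne',
    show -(α / 2 + 1) = -(1 / 2) * α - 1 by ring, rpow_sub_one hQ.ne']
  ring

theorem norm_one_add_exp {ψ : ℝ} (hψ : ψ ∈ Ioo (-π) π) :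
    ‖1 + Complex.exp (Complex.I * ψ)‖ = 2 * cos (ψ / 2) := by
  have hc : 0 < cos (ψ / 2) := cos_pos_of_mem_Ioo ⟨by linarith [hψ.1], by linarith [hψ.2]⟩
  have h := norm_add_mul_exp_sq 1 ψ
  rw [Complex.ofReal_one, one_mul] at h
  rw [← sq_eq_sq₀ (norm_nonneg _) (by positivity), h]
  have := cos_sq (ψ / 2)
  rw [mul_div_cancel₀ ψ two_ne_zero] at this
  linear_combination (-4 : ℝ) * this

/-- A bound that is uniform in `ρ` and integrable in `ψ`. -/
theorem norm_one_add_mul_exp_rpow_le {α ρ ψ : ℝ} (h0 : 0 ≤ ρ) (h1 : ρ < 1)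
    (hψ : ψ ∈ Ioo (-π) π) :
    ‖1 + (ρ : ℂ) * Complex.exp (Complex.I * ψ)‖ ^ α
      ≤ 2 ^ |α| * (1 + (2 * cos (ψ / 2)) ^ α) := by
  have hc : 0 < 2 * cos (ψ / 2) :=
    mul_pos two_pos (cos_pos_of_mem_Ioo ⟨by linarith [hψ.1], by linarith [hψ.2]⟩)
  have hexp : ‖Complex.exp (Complex.I * ψ)‖ = 1 := by
    rw [mul_comm, Complex.norm_exp_ofReal_mul_I]
  have hn0 : 0 < ‖1 + (ρ : ℂ) * Complex.exp (Complex.I * ψ)‖ :=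
    norm_pos_iff.2 (one_add_mul_exp_ne_zero h0 h1 ψ)
  have hcα := rpow_pos_of_pos hc α
  rcases le_total 0 α with hα | hα
  · have hle : ‖1 + (ρ : ℂ) * Complex.exp (Complex.I * ψ)‖ ≤ 2 := by
      refine (norm_add_le _ _).trans ?_
      rw [norm_mul, hexp, norm_one, Complex.norm_real, norm_of_nonneg h0]
      linarith
    rw [abs_of_nonneg hα]
    refine (rpow_le_rpow hn0.le hle hα).trans (le_mul_of_one_le_right (by positivity) ?_)
    linarith
  · -- The distance from `-ρ e^{iψ}` to `1` is at least half the distance from `-e^{iψ}` to `1`.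
    have hge : 2 * cos (ψ / 2) / 2 ≤ ‖1 + (ρ : ℂ) * Complex.exp (Complex.I * ψ)‖ := by
      rw [← norm_one_add_exp hψ]
      have e : 1 + Complex.exp (Complex.I * ψ) = (1 + ρ * Complex.exp (Complex.I * ψ))
          + ((1 - ρ : ℝ) : ℂ) * Complex.exp (Complex.I * ψ) := by push_cast; ring
      have h2 : ‖1 + Complex.exp (Complex.I * ψ)‖
          ≤ ‖1 + (ρ : ℂ) * Complex.exp (Complex.I * ψ)‖ + (1 - ρ) := by
        rw [e]
        refine (norm_add_le _ _).trans ?_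
        rw [norm_mul ((1 - ρ : ℝ) : ℂ), hexp, Complex.norm_real, norm_of_nonneg (by linarith)]
        simp
      have h3 : 1 - ρ ≤ ‖1 + (ρ : ℂ) * Complex.exp (Complex.I * ψ)‖ := by
        have := norm_sub_norm_le (1 : ℂ) (-((ρ : ℂ) * Complex.exp (Complex.I * ψ)))
        rw [norm_neg, norm_mul, hexp, norm_one, Complex.norm_real, norm_of_nonneg h0,
          sub_neg_eq_add] at this
        linarith
      linarith
    rw [abs_of_nonpos hα]
    refine (rpow_le_rpow_of_nonpos (by positivity) hge hα).trans ?_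
    rw [div_rpow hc.le two_pos.le, rpow_neg two_pos.le, div_eq_mul_inv, mul_comm]
    gcongr
    linarith

/-- `K_α(ρ e^{it}) dt / 2π` is an approximate identity as `ρ → 1`. -/
theorem tendsto_integral_polarKernel_mul {H : ℂ → ℝ} (hH : ContinuousOn H (Metric.closedBall 0 1))
    {α : ℝ} (hα : -1 < α) :
    Tendsto (fun ρ => ∫ t in (-π)..π, polarKernel α ρ t * H (Complex.exp (Complex.I * t)))
      (𝓝[<] 1) (𝓝 (2 * π * H 1)) := by
  have hmem : ∀ᶠ ρ : ℝ in 𝓝[<] 1, ρ ∈ Ico (0 : ℝ) 1 := Ico_mem_nhdsLT one_pos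
  obtain ⟨C, hC⟩ := (isCompact_closedBall (0 : ℂ) 1).exists_bound_of_continuousOn hH
  have hpp : -π < π := by linarith [pi_pos]
  have hne : ∀ᵐ ψ : ℝ, ψ ∈ uIoc (-π) π → ψ ∈ Ioo (-π) π := by
    filter_upwards [compl_mem_ae_iff.2 (measure_singleton π)] with ψ hψ h
    rw [uIoc_of_le hpp.le] at h
    exact ⟨h.1, lt_of_le_of_ne h.2 hψ⟩
  have hlim : Tendsto (fun ρ : ℝ => ∫ ψ in (-π)..π,
      ‖1 + (ρ : ℂ) * Complex.exp (Complex.I * ψ)‖ ^ α * H (moebiusPoint ρ ψ)) (𝓝[<] 1)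
      (𝓝 (∫ ψ in (-π)..π, (2 * cos (ψ / 2)) ^ α * H 1)) := by
    refine intervalIntegral.tendsto_integral_filter_of_dominated_convergence
      (fun ψ => 2 ^ |α| * (1 + (2 * cos (ψ / 2)) ^ α) * C) ?_ ?_ ?_ ?_
    · filter_upwards [hmem] with ρ hρ
      refine Continuous.aestronglyMeasurable ?_
      refine Continuous.mul (Continuous.rpow_const (by fun_prop) fun ψ => Or.inl ?_) ?_
      · exact norm_ne_zero_iff.2 (one_add_mul_exp_ne_zero hρ.1 hρ.2 ψ)
      · refine hH.comp_continuous ?_ fun ψ => by simpa using norm_moebiusPoint_le_one ρ ψ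
        unfold moebiusPoint
        exact Continuous.div (by fun_prop) (by fun_prop)
          fun ψ => one_add_mul_exp_ne_zero hρ.1 hρ.2 ψ
    · filter_upwards [hmem] with ρ hρ
      filter_upwards [hne] with ψ hψ hψm
      rw [norm_mul, norm_of_nonneg (rpow_nonneg (norm_nonneg _) _)]
      have hc : 0 < 2 * cos (ψ / 2) := mul_pos two_pos
        (cos_pos_of_mem_Ioo ⟨by linarith [(hψ hψm).1], by linarith [(hψ hψm).2]⟩)
      exact mul_le_mul (norm_one_add_mul_exp_rpow_le hρ.1 hρ.2 (hψ hψm))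
        (hC _ (by simpa using norm_moebiusPoint_le_one ρ ψ)) (norm_nonneg _) (by positivity)
    · rw [intervalIntegrable_iff_integrableOn_Ioo_of_le hpp.le]
      exact (((integrableOn_const (by simp)).add
        (integrableOn_two_mul_cos_half_rpow hα)).const_mul _).mul_const _
    · filter_upwards [hne] with ψ hψ hψm
      have hn := norm_one_add_exp (hψ hψm)
      have hc : 0 < 2 * cos (ψ / 2) := mul_pos two_pos
        (cos_pos_of_mem_Ioo ⟨by linarith [(hψ hψm).1], by linarith [(hψ hψm).2]⟩)
      have hne0 : 1 + ((1 : ℝ) : ℂ) * Complex.exp (Complex.I * ψ) ≠ 0 := by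
        rw [← norm_ne_zero_iff, Complex.ofReal_one, one_mul, hn]; exact hc.ne'
      have hid : Tendsto (fun ρ : ℝ => ρ) (𝓝[<] 1) (𝓝 1) := tendsto_id.mono_left nhdsWithin_le_nhds
      refine Tendsto.mul ?_ ?_
      · have hcont : ContinuousAt
            (fun ρ : ℝ => ‖1 + (ρ : ℂ) * Complex.exp (Complex.I * ψ)‖ ^ α) 1 :=
          ContinuousAt.rpow_const (by fun_prop) (Or.inl (norm_ne_zero_iff.2 hne0))
        have := hcont.tendsto.comp hid
        rwa [Complex.ofReal_one, one_mul, hn] at this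
      · have hcont : ContinuousAt (fun ρ : ℝ => moebiusPoint ρ ψ) 1 := by
          unfold moebiusPoint
          exact ContinuousAt.div (by fun_prop) (by fun_prop) hne0
        have h1 : moebiusPoint 1 ψ = 1 := by
          rw [moebiusPoint, div_eq_one_iff_eq hne0]; push_cast; ring
        have := hcont.tendsto.comp hid
        rw [h1] at this
        refine (hH 1 (by simp)).tendsto.comp (tendsto_nhdsWithin_iff.2 ⟨this, ?_⟩)
        exact Eventually.of_forall fun ρ => by simpa using norm_moebiusPoint_le_one ρ ψ
  have hval : kernelConst α * ∫ ψ in (-π)..π, (2 * cos (ψ / 2)) ^ α * H 1 = 2 * π * H 1 := by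
    have hk := (kernelConst_pos hα).ne'
    rw [intervalIntegral.integral_mul_const, intervalIntegral.integral_of_le hpp.le,
      integral_Ioc_eq_integral_Ioo, integral_two_mul_cos_half_rpow hα]
    field_simp
  rw [← hval]
  refine (hlim.const_mul (kernelConst α)).congr' ?_
  filter_upwards [hmem] with ρ hρ
  exact (integral_polarKernel_mul hH α hρ.1 hρ.2).symm

/-! ### The circular means of the kernel -/

theorem periodic_polarKernel (α r : ℝ) : Function.Periodic (polarKernel α r) (2 * π) := by
  intro θ
  simp only [polarKernel, cos_add_two_pi]

theorem meanK_eq_integral_polarKernel (α r : ℝ) :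
    meanK α r = (1 / (2 * π)) * ∫ θ in (-π)..π, polarKernel α r θ := by
  rw [meanK]
  simp only [kernelK_ofReal_mul_exp]
  have := (periodic_polarKernel α r).intervalIntegral_add_eq 0 (-π)
  rw [zero_add, show -π + 2 * π = π by ring] at this
  rw [this]

theorem meanK_eq_integral_norm_rpow (α : ℝ) {r : ℝ} (h0 : 0 ≤ r) (h1 : r < 1) :
    meanK α r = (1 / (2 * π)) * (kernelConst α
      * ∫ ψ in (-π)..π, ‖1 + (r : ℂ) * Complex.exp (Complex.I * ψ)‖ ^ α) := by
  have h := integral_polarKernel_mul (H := fun _ => 1) continuousOn_const α h0 h1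
  simp only [mul_one] at h
  rw [meanK_eq_integral_polarKernel, h]

theorem tendsto_meanK {α : ℝ} (hα : -1 < α) : Tendsto (meanK α) (𝓝[<] 1) (𝓝 1) := by
  have h := (tendsto_integral_polarKernel_mul (H := fun _ => 1) continuousOn_const hα).const_mul
    (1 / (2 * π))
  simp only [mul_one] at h
  rw [one_div_mul_cancel two_pi_pos.ne'] at h
  exact h.congr fun r => (meanK_eq_integral_polarKernel α r).symm

theorem integral_exp_mul_exp_neg (m n : ℕ) :
    ∫ ψ in (-π)..π, Complex.exp (Complex.I * ψ) ^ m * Complex.exp (Complex.I * (-ψ : ℝ)) ^ n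
      = if m = n then 2 * (π : ℂ) else 0 := by
  have e : ∀ ψ : ℝ, Complex.exp (Complex.I * ψ) ^ m * Complex.exp (Complex.I * (-ψ : ℝ)) ^ n
      = Complex.exp ((((m : ℂ) - n) * Complex.I) * ψ) := by
    intro ψ
    rw [← Complex.exp_nat_mul, ← Complex.exp_nat_mul, ← Complex.exp_add]
    congr 1; push_cast; ring
  simp only [e]
  split_ifs with h
  · subst h
    simp
    ring
  · have hmn : ((m : ℂ) - n) ≠ 0 := sub_ne_zero.2 (by exact_mod_cast h)
    rw [integral_exp_mul_complex (mul_ne_zero hmn Complex.I_ne_zero)]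
    have : Complex.exp (((m : ℂ) - n) * Complex.I * (π : ℝ))
        = Complex.exp (((m : ℂ) - n) * Complex.I * (-π : ℝ)) := by
      rw [Complex.exp_eq_exp_iff_exists_int]
      exact ⟨(m : ℤ) - n, by push_cast; ring⟩
    rw [this, sub_self, zero_div]

theorem hasSum_binomial {a r : ℝ} (h0 : 0 ≤ r) (h1 : r < 1) (ψ : ℝ) :
    HasSum (fun n : ℕ => ((Ring.choose a n * r ^ n : ℝ) : ℂ) * Complex.exp (Complex.I * ψ) ^ n)
      ((1 + (r : ℂ) * Complex.exp (Complex.I * ψ)) ^ (a : ℂ)) := by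
  have hz : (r : ℂ) * Complex.exp (Complex.I * ψ) ∈ Metric.eball (0 : ℂ) 1 := by
    rw [← ENNReal.ofReal_one, Metric.eball_ofReal, mem_ball_zero_iff, norm_mul,
      mul_comm Complex.I, Complex.norm_exp_ofReal_mul_I, mul_one, Complex.norm_real,
      norm_of_nonneg h0]
    exact h1
  have h := (Complex.one_add_cpow_hasFPowerSeriesOnBall_zero (a := (a : ℂ))).hasSum hz
  rw [zero_add] at h
  refine h.congr_fun ?_
  intro n
  rw [binomialSeries_apply]
  rw [← Complex.ofReal_choose]
  simp [mul_pow, mul_assoc]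

theorem summable_abs_binomial (a : ℝ) {r : ℝ} (h0 : 0 ≤ r) (h1 : r < 1) :
    Summable fun n : ℕ => |Ring.choose a n * r ^ n| := by
  have h := (hasSum_binomial (a := a) h0 h1 0).summable.norm
  simpa using h

theorem hasSum_integral_binomial_mul (a : ℝ) {r : ℝ} (h0 : 0 ≤ r) (h1 : r < 1) {h : ℝ → ℂ}
    (hh : Continuous h) :
    HasSum (fun n : ℕ => ((Ring.choose a n * r ^ n : ℝ) : ℂ)
        * ∫ ψ in (-π)..π, Complex.exp (Complex.I * ψ) ^ n * h ψ)
      (∫ ψ in (-π)..π, (1 + (r : ℂ) * Complex.exp (Complex.I * ψ)) ^ (a : ℂ) * h ψ) := by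
  simp only [← intervalIntegral.integral_const_mul]
  refine intervalIntegral.hasSum_integral_of_dominated_convergence
    (fun n ψ => |Ring.choose a n * r ^ n| * ‖h ψ‖) ?_ ?_ ?_ ?_ ?_
  · intro n
    exact Continuous.aestronglyMeasurable (by fun_prop)
  · intro n
    refine ae_of_all _ fun ψ _ => ?_
    rw [norm_mul, norm_mul, norm_pow, mul_comm Complex.I, Complex.norm_exp_ofReal_mul_I, one_pow,
      one_mul, Complex.norm_real, norm_eq_abs]
  · exact ae_of_all _ fun ψ _ => (summable_abs_binomial a h0 h1).mul_right _
  · simp only [tsum_mul_right]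
    exact Continuous.intervalIntegrable (by fun_prop) _ _
  · refine ae_of_all _ fun ψ _ => ?_
    simpa only [mul_assoc] using (hasSum_binomial (a := a) h0 h1 ψ).mul_right (h ψ)

/-- Parseval's identity for the binomial series of `(1 + z) ^ (α / 2)`. -/
theorem hasSum_meanK (α : ℝ) {r : ℝ} (h0 : 0 ≤ r) (h1 : r < 1) :
    HasSum (fun n : ℕ => kernelConst α * (Ring.choose (α / 2) n ^ 2 * (r ^ 2) ^ n))
      (meanK α r) := by
  set a : ℝ := α / 2 with ha
  set g : ℝ → ℂ := fun ψ => (1 + (r : ℂ) * Complex.exp (Complex.I * ψ)) ^ (a : ℂ) with hg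
  have hre : ∀ ψ : ℝ, 0 < (1 + (r : ℂ) * Complex.exp (Complex.I * ψ)).re := by
    intro ψ
    have := one_sub_mul_cos_pos h0 h1 (ψ + π)
    rw [cos_add_pi] at this
    have e : 1 + (r : ℂ) * Complex.exp (Complex.I * ψ)
        = ((1 + r * cos ψ : ℝ) : ℂ) + ((r * sin ψ : ℝ) : ℂ) * Complex.I := by
      rw [exp_I_mul_ofReal]; push_cast; ring
    rw [e, Complex.add_re, Complex.ofReal_re, Complex.re_ofReal_mul, Complex.I_re]
    linarith
  have hgc : Continuous g := by
    refine Continuous.cpow (by fun_prop) continuous_const fun ψ => Or.inl (hre ψ)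
  have hconj : ∀ ψ : ℝ, (starRingEnd ℂ) (g ψ) = g (-ψ) := by
    intro ψ
    have hpi : (1 + (r : ℂ) * Complex.exp (Complex.I * ψ)).arg ≠ π :=
      Complex.slitPlane_arg_ne_pi (Or.inl (hre ψ))
    simp only [hg]
    have h := Complex.conj_cpow _ (a : ℂ) hpi
    rw [Complex.conj_ofReal] at h
    rw [← h, map_add, map_one, map_mul, Complex.conj_ofReal, ← Complex.exp_conj, map_mul,
      Complex.conj_I, Complex.conj_ofReal, Complex.ofReal_neg, mul_neg, neg_mul]
  have hcoef : ∀ n : ℕ, ∫ ψ in (-π)..π, Complex.exp (Complex.I * ψ) ^ n * g (-ψ)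
      = ((Ring.choose a n * r ^ n : ℝ) : ℂ) * (2 * π) := by
    intro n
    have hswap : ∫ ψ in (-π)..π, Complex.exp (Complex.I * ψ) ^ n * g (-ψ)
        = ∫ ψ in (-π)..π, g ψ * Complex.exp (Complex.I * (-ψ : ℝ)) ^ n := by
      have := intervalIntegral.integral_comp_neg (a := -π) (b := π)
        (fun ψ : ℝ => g ψ * Complex.exp (Complex.I * (-ψ : ℝ)) ^ n)
      rw [neg_neg] at this
      rw [← this]
      refine intervalIntegral.integral_congr fun ψ _ => ?_
      simp only [neg_neg]
      ring
    have h := hasSum_integral_binomial_mul a h0 h1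
      (h := fun ψ : ℝ => Complex.exp (Complex.I * (-ψ : ℝ)) ^ n) (by fun_prop)
    simp only [integral_exp_mul_exp_neg, mul_ite, mul_zero] at h
    rw [hswap]
    have h2 := hasSum_single (f := fun m : ℕ => if m = n then
      ((Ring.choose a m * r ^ m : ℝ) : ℂ) * (2 * π) else 0) n fun m hm => if_neg hm
    rw [if_pos rfl] at h2
    exact h.unique h2
  have hnorm : ∀ ψ : ℝ, g ψ * g (-ψ)
      = ((‖1 + (r : ℂ) * Complex.exp (Complex.I * ψ)‖ ^ α : ℝ) : ℂ) := by
    intro ψ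
    rw [← hconj, Complex.mul_conj', hg]
    simp only
    rw [Complex.norm_cpow_real, ← Complex.ofReal_pow, ← rpow_natCast, ← rpow_mul (norm_nonneg _),
      ha]
    congr 2; push_cast; ring
  have h := hasSum_integral_binomial_mul a h0 h1 (h := fun ψ => g (-ψ)) (by fun_prop)
  simp only [hcoef] at h
  change HasSum _ (∫ ψ in (-π)..π, g ψ * g (-ψ)) at h
  simp only [hnorm, intervalIntegral.integral_ofReal] at h
  have h' : HasSum (fun n : ℕ => Ring.choose a n * r ^ n * (Ring.choose a n * r ^ n * (2 * π)))
      (∫ ψ in (-π)..π, ‖1 + (r : ℂ) * Complex.exp (Complex.I * ψ)‖ ^ α) := by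
    rw [← Complex.hasSum_ofReal]
    exact_mod_cast h
  rw [meanK_eq_integral_norm_rpow α h0 h1]
  convert! (h'.mul_left (kernelConst α)).mul_left (1 / (2 * π)) using 2 with n
  field_simp
  ring

theorem ascPochhammer_eval_neg_eq_choose (a : ℝ) (n : ℕ) :
    (ascPochhammer ℝ n).eval (-a) = (-1) ^ n * (n.factorial * Ring.choose a n) := by
  have hn : (n.factorial : ℝ) ≠ 0 := by exact_mod_cast n.factorial_ne_zero
  rw [ascPochhammer_eval_neg_eq_descPochhammer, descPochhammer_eval_eq_ascPochhammer]
  congr 1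
  simp only [Ring.choose_eq_smul, Polynomial.descPochhammer_smeval_eq_ascPochhammer,
    Polynomial.ascPochhammer_smeval_cast, Polynomial.ascPochhammer_smeval_eq_eval, smul_eq_mul]
  field_simp

theorem ordinaryHypergeometric_neg_neg_one (a x : ℝ) :
    ordinaryHypergeometric (-a) (-a) (1 : ℝ) x = ∑' n : ℕ, Ring.choose a n ^ 2 * x ^ n := by
  rw [ordinaryHypergeometric_eq_tsum]
  refine tsum_congr fun n => ?_
  have hn : (n.factorial : ℝ) ≠ 0 := by exact_mod_cast n.factorial_ne_zero
  rw [ascPochhammer_eval_one, ascPochhammer_eval_neg_eq_choose, smul_eq_mul]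
  have h1 : ((-1 : ℝ) ^ n) ^ 2 = 1 := by rw [← pow_mul, mul_comm, pow_mul]; simp
  field_simp
  rw [h1, one_mul]

theorem meanK_eq_hypergeometric (α : ℝ) {r : ℝ} (h0 : 0 ≤ r) (h1 : r < 1) :
    meanK α r = kernelConst α * ordinaryHypergeometric (-(α / 2)) (-(α / 2)) (1 : ℝ) (r ^ 2) := by
  rw [ordinaryHypergeometric_neg_neg_one, ← tsum_mul_left, (hasSum_meanK α h0 h1).tsum_eq]

/-- The mean increases with `r`, as its power series has nonnegative coefficients, and tends to
`1` at the boundary. -/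
theorem meanK_le_one {α : ℝ} (hα : -1 < α) {r : ℝ} (h0 : 0 ≤ r) (h1 : r < 1) :
    meanK α r ≤ 1 := by
  refine ge_of_tendsto (tendsto_meanK hα) ?_
  filter_upwards [Ioo_mem_nhdsLT h1] with ρ hρ
  have hk := (kernelConst_pos hα).le
  refine hasSum_le (fun n => ?_) (hasSum_meanK α h0 h1) (hasSum_meanK α (h0.trans hρ.1.le) hρ.2)
  have := hρ.1.le
  gcongr

/-! ### The kernel solves the equation -/

/-- `∂_r log K_α` in polar coordinates. -/
noncomputable def kernelLogDerivR (α r θ : ℝ) : ℝ :=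
  -2 * (α + 1) * r / (1 - r ^ 2) - (α + 2) * (r - cos θ) / (1 - 2 * r * cos θ + r ^ 2)

/-- `∂_r² log K_α` in polar coordinates. -/
noncomputable def kernelLogDerivRR (α r θ : ℝ) : ℝ :=
  -2 * (α + 1) * (1 + r ^ 2) / (1 - r ^ 2) ^ 2
    - (α + 2) * (1 / (1 - 2 * r * cos θ + r ^ 2)
      - 2 * (r - cos θ) ^ 2 / (1 - 2 * r * cos θ + r ^ 2) ^ 2)

/-- `∂_θ log K_α` in polar coordinates. -/
noncomputable def kernelLogDerivA (α r θ : ℝ) : ℝ :=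
  -(α + 2) * (r * sin θ) / (1 - 2 * r * cos θ + r ^ 2)

/-- `∂_θ² log K_α` in polar coordinates. -/
noncomputable def kernelLogDerivAA (α r θ : ℝ) : ℝ :=
  -(α + 2) * (r * cos θ / (1 - 2 * r * cos θ + r ^ 2)
    - 2 * r ^ 2 * sin θ ^ 2 / (1 - 2 * r * cos θ + r ^ 2) ^ 2)

theorem one_sub_sq_pos {r : ℝ} (hr : r ∈ Ioo (-1 : ℝ) 1) : 0 < 1 - r ^ 2 := by
  nlinarith [hr.1, hr.2]

theorem hasDerivAt_one_sub_sq (r : ℝ) : HasDerivAt (fun s : ℝ => 1 - s ^ 2) (-(2 * r)) r := by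
  simpa using (hasDerivAt_pow 2 r).const_sub 1

theorem hasDerivAt_distSq_radial (r θ : ℝ) :
    HasDerivAt (fun s : ℝ => 1 - 2 * s * cos θ + s ^ 2) (2 * (r - cos θ)) r := by
  have h := (((hasDerivAt_id r).const_mul (2 * cos θ)).const_sub 1).add (hasDerivAt_pow 2 r)
  refine (h.congr_of_eventuallyEq (Eventually.of_forall fun s => ?_)).congr_deriv ?_
  · simp; ring
  · simp; ring

theorem hasDerivAt_distSq_angular (r θ : ℝ) :
    HasDerivAt (fun t : ℝ => 1 - 2 * r * cos t + r ^ 2) (2 * r * sin θ) θ := by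
  have h := (((hasDerivAt_cos θ).const_mul (2 * r)).const_sub 1).add_const (r ^ 2)
  exact h.congr_deriv (by ring)

section KernelDerivatives

variable {α r : ℝ}

theorem hasDerivAt_polarKernel_radial (hr : r ∈ Ioo (-1 : ℝ) 1) (θ : ℝ) :
    HasDerivAt (fun s => polarKernel α s θ) (polarKernel α r θ * kernelLogDerivR α r θ) r := by
  have hw := one_sub_sq_pos hr
  have hQ := one_sub_two_mul_cos_add_sq_pos hr θ
  have h := (((hasDerivAt_one_sub_sq r).rpow_const (p := α + 1) (Or.inl hw.ne')).mul
    ((hasDerivAt_distSq_radial r θ).rpow_const (p := -(α / 2 + 1)) (Or.inl hQ.ne'))).const_mul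
    (kernelConst α)
  refine h.congr_deriv ?_
  rw [rpow_sub_one hw.ne', rpow_sub_one hQ.ne', polarKernel, kernelLogDerivR]
  field_simp
  ring

theorem hasDerivAt_polarKernel_angular (hr : r ∈ Ioo (-1 : ℝ) 1) (θ : ℝ) :
    HasDerivAt (polarKernel α r) (polarKernel α r θ * kernelLogDerivA α r θ) θ := by
  have hQ := one_sub_two_mul_cos_add_sq_pos hr θ
  have h := (((hasDerivAt_distSq_angular r θ).rpow_const (p := -(α / 2 + 1))
    (Or.inl hQ.ne')).const_mul ((1 - r ^ 2) ^ (α + 1))).const_mul (kernelConst α)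
  refine h.congr_deriv ?_
  rw [rpow_sub_one hQ.ne', polarKernel, kernelLogDerivA]
  field_simp

theorem hasDerivAt_kernelLogDerivR (hr : r ∈ Ioo (-1 : ℝ) 1) (θ : ℝ) :
    HasDerivAt (fun s => kernelLogDerivR α s θ) (kernelLogDerivRR α r θ) r := by
  have hw := one_sub_sq_pos hr
  have hQ := one_sub_two_mul_cos_add_sq_pos hr θ
  have h := (((hasDerivAt_id r).const_mul (-2 * (α + 1))).div (hasDerivAt_one_sub_sq r) hw.ne').sub
    ((((hasDerivAt_id r).sub_const (cos θ)).const_mul (α + 2)).div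
      (hasDerivAt_distSq_radial r θ) hQ.ne')
  refine h.congr_deriv ?_
  rw [kernelLogDerivRR]
  simp only [id]
  field_simp
  ring

theorem hasDerivAt_kernelLogDerivA (hr : r ∈ Ioo (-1 : ℝ) 1) (θ : ℝ) :
    HasDerivAt (kernelLogDerivA α r) (kernelLogDerivAA α r θ) θ := by
  have hQ := one_sub_two_mul_cos_add_sq_pos hr θ
  have h := (((hasDerivAt_sin θ).const_mul r).const_mul (-(α + 2))).div
      (hasDerivAt_distSq_angular r θ) hQ.ne'
  refine h.congr_deriv ?_
  rw [kernelLogDerivAA]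
  field_simp
  ring

end KernelDerivatives

theorem isPolarSolution_polarKernel (α : ℝ) :
    IsPolarSolution α (polarKernel α)
      (fun r θ => polarKernel α r θ * kernelLogDerivR α r θ)
      (fun r θ => polarKernel α r θ * (kernelLogDerivR α r θ ^ 2 + kernelLogDerivRR α r θ))
      (fun r θ => polarKernel α r θ * kernelLogDerivA α r θ)
      (fun r θ => polarKernel α r θ * (kernelLogDerivA α r θ ^ 2 + kernelLogDerivAA α r θ)) := by
  have hw : ∀ p ∈ Ioo (-1 : ℝ) 1 ×ˢ (univ : Set ℝ), 1 - p.1 ^ 2 ≠ 0 := fun p hp =>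
    (one_sub_sq_pos hp.1).ne'
  have hQ : ∀ p ∈ Ioo (-1 : ℝ) 1 ×ˢ (univ : Set ℝ), 1 - 2 * p.1 * cos p.2 + p.1 ^ 2 ≠ 0 :=
    fun p hp => (one_sub_two_mul_cos_add_sq_pos hp.1 p.2).ne'
  have hw2 : ∀ p ∈ Ioo (-1 : ℝ) 1 ×ˢ (univ : Set ℝ), (1 - p.1 ^ 2) ^ 2 ≠ 0 := fun p hp =>
    pow_ne_zero 2 (hw p hp)
  have hQ2 : ∀ p ∈ Ioo (-1 : ℝ) 1 ×ˢ (univ : Set ℝ), (1 - 2 * p.1 * cos p.2 + p.1 ^ 2) ^ 2 ≠ 0 :=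
    fun p hp => pow_ne_zero 2 (hQ p hp)
  have cK : ContinuousOn (fun p : ℝ × ℝ => polarKernel α p.1 p.2) (Ioo (-1) 1 ×ˢ univ) := by
    unfold polarKernel
    refine continuousOn_const.mul (ContinuousOn.mul ?_ ?_)
    · exact ContinuousOn.rpow_const (by fun_prop) fun p hp => Or.inl (hw p hp)
    · exact ContinuousOn.rpow_const (by fun_prop) fun p hp => Or.inl (hQ p hp)
  have cR : ContinuousOn (fun p : ℝ × ℝ => kernelLogDerivR α p.1 p.2) (Ioo (-1) 1 ×ˢ univ) := by
    unfold kernelLogDerivR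
    fun_prop (disch := assumption)
  have cRR : ContinuousOn (fun p : ℝ × ℝ => kernelLogDerivRR α p.1 p.2) (Ioo (-1) 1 ×ˢ univ) := by
    unfold kernelLogDerivRR
    fun_prop (disch := assumption)
  have cA : ContinuousOn (fun p : ℝ × ℝ => kernelLogDerivA α p.1 p.2) (Ioo (-1) 1 ×ˢ univ) := by
    unfold kernelLogDerivA
    fun_prop (disch := assumption)
  have cAA : ContinuousOn (fun p : ℝ × ℝ => kernelLogDerivAA α p.1 p.2) (Ioo (-1) 1 ×ˢ univ) := by
    unfold kernelLogDerivAA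
    fun_prop (disch := assumption)
  exact
  { cont := cK
    cont_r := cK.fun_mul cR
    cont_rr := cK.fun_mul ((cR.fun_pow 2).fun_add cRR)
    cont_θ := cK.fun_mul cA
    cont_θθ := cK.fun_mul ((cA.fun_pow 2).fun_add cAA)
    deriv_r := fun r hr θ => hasDerivAt_polarKernel_radial hr θ
    deriv_rr := fun r hr θ => ((hasDerivAt_polarKernel_radial hr θ).mul
      (hasDerivAt_kernelLogDerivR hr θ)).congr_deriv (by ring)
    deriv_θ := fun r hr θ => hasDerivAt_polarKernel_angular hr θ
    deriv_θθ := fun r hr θ => ((hasDerivAt_polarKernel_angular hr θ).mul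
      (hasDerivAt_kernelLogDerivA hr θ)).congr_deriv (by ring)
    periodic := periodic_polarKernel α
    periodic_θ := fun r θ => by
      simp only [polarKernel, kernelLogDerivA, cos_add_two_pi, sin_add_two_pi]
    pde := fun r hr θ => by
      have hr' : r ∈ Ioo (-1 : ℝ) 1 := ⟨by linarith [hr.1], hr.2⟩
      have hw := (one_sub_sq_pos hr').ne'
      have hQ := (one_sub_two_mul_cos_add_sq_pos hr' θ).ne'
      have key : (1 - r ^ 2) * (r ^ 2 * (kernelLogDerivR α r θ ^ 2 + kernelLogDerivRR α r θ)
          + r * kernelLogDerivR α r θ + (kernelLogDerivA α r θ ^ 2 + kernelLogDerivAA α r θ))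
          + 2 * α * r ^ 3 * kernelLogDerivR α r θ - α ^ 2 * r ^ 2 = 0 := by
        rw [kernelLogDerivR, kernelLogDerivRR, kernelLogDerivA, kernelLogDerivAA]
        have hs : sin θ ^ 2 = 1 - cos θ ^ 2 := sin_sq θ
        rw [hs]
        generalize cos θ = a at *
        generalize hQe : 1 - 2 * r * a + r ^ 2 = Q at *
        generalize hWe : 1 - r ^ 2 = W at *
        have hB : (-(α + 2) * (r * sin θ) / Q) ^ 2 = (α + 2) ^ 2 * r ^ 2 * (1 - a ^ 2) / Q ^ 2 := by
          rw [div_pow, mul_pow, mul_pow r, hs]; ring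
        rw [hB]
        field_simp
        subst hQe hWe
        ring
      linear_combination polarKernel α r θ * key }

/-! ### Solutions on the disk in polar coordinates -/

theorem norm_ofReal_mul_exp (r θ : ℝ) : ‖(r : ℂ) * Complex.exp (Complex.I * θ)‖ = |r| := by
  rw [norm_mul, mul_comm Complex.I, Complex.norm_exp_ofReal_mul_I, mul_one, Complex.norm_real,
    norm_eq_abs]

theorem ofReal_mul_exp_mem_ball {r : ℝ} (hr : r ∈ Ioo (-1 : ℝ) 1) (θ : ℝ) :
    (r : ℂ) * Complex.exp (Complex.I * θ) ∈ Metric.ball (0 : ℂ) 1 := by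
  rw [mem_ball_zero_iff, norm_ofReal_mul_exp]
  exact abs_lt.2 hr

/-- The equation `T_α f = 0` with the positive factor `(1 - |z|²) ^ (-α - 1) / 4` removed; the
first order term is the radial derivative `D f(z) z`. -/
theorem opT_eq_zero_iff (α : ℝ) (f : ℂ → ℂ) {z : ℂ} (hz : z ∈ Metric.ball (0 : ℂ) 1) :
    opT α f z = 0 ↔ ((1 - ‖z‖ ^ 2 : ℝ) : ℂ) * (fderiv ℝ (fderiv ℝ f) z 1 1
        + fderiv ℝ (fderiv ℝ f) z Complex.I Complex.I)
      + 2 * α * fderiv ℝ f z z - α ^ 2 * f z = 0 := by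
  have hw : 0 < 1 - ‖z‖ ^ 2 := by
    have h1 : ‖z‖ < 1 := by simpa using hz
    nlinarith [norm_nonneg z]
  have hlap : Laplacian.laplacian f z = fderiv ℝ (fderiv ℝ f) z 1 1
      + fderiv ℝ (fderiv ℝ f) z Complex.I Complex.I := by
    rw [InnerProductSpace.laplacian_eq_iteratedFDeriv_complexPlane]
    simp [iteratedFDeriv_two_apply]
  have hrad : z * wirtingerDz f z + (starRingEnd ℂ) z * wirtingerDzbar f z = fderiv ℝ f z z := by
    have e : fderiv ℝ f z z = z.re * fderiv ℝ f z 1 + z.im * fderiv ℝ f z Complex.I := by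
      have hz : z = z.re • (1 : ℂ) + z.im • Complex.I := by simp [Complex.re_add_im]
      calc fderiv ℝ f z z = fderiv ℝ f z (z.re • (1 : ℂ) + z.im • Complex.I) := by rw [← hz]
        _ = _ := by rw [map_add, map_smul, map_smul, Complex.real_smul, Complex.real_smul]
    have h1 : z = z.re + z.im * Complex.I := (Complex.re_add_im z).symm
    have h2 : (starRingEnd ℂ) z = z.re - z.im * Complex.I := by
      apply Complex.ext <;> simp
    rw [e, wirtingerDz, wirtingerDzbar, h2]
    linear_combination (1 / 2 * (fderiv ℝ f z 1 - Complex.I * fderiv ℝ f z Complex.I)) * h1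
      - z.im * fderiv ℝ f z Complex.I * Complex.I_sq
  have hpow : (1 - ‖z‖ ^ 2) ^ (-α) = (1 - ‖z‖ ^ 2) ^ (-α - 1) * (1 - ‖z‖ ^ 2) := by
    rw [← rpow_add_one hw.ne']; congr 1; ring
  have hp : (((1 - ‖z‖ ^ 2) ^ (-α - 1) : ℝ) : ℂ) ≠ 0 := by
    exact_mod_cast (rpow_pos_of_pos hw _).ne'
  have e : opT α f z = (((1 - ‖z‖ ^ 2) ^ (-α - 1) : ℝ) : ℂ) / 4
      * (((1 - ‖z‖ ^ 2 : ℝ) : ℂ) * (fderiv ℝ (fderiv ℝ f) z 1 1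
        + fderiv ℝ (fderiv ℝ f) z Complex.I Complex.I)
      + 2 * α * fderiv ℝ f z z - α ^ 2 * f z) := by
    rw [opT, hrad, hlap, hpow]
    push_cast
    ring
  rw [e, mul_eq_zero, or_iff_right (div_ne_zero hp (by norm_num))]

theorem hasDerivAt_ofReal_mul_exp_radial (r θ : ℝ) :
    HasDerivAt (fun s : ℝ => (s : ℂ) * Complex.exp (Complex.I * θ))
      (Complex.exp (Complex.I * θ)) r := by
  simpa using (Complex.ofRealCLM.hasDerivAt (x := r)).mul_const (Complex.exp (Complex.I * θ))

theorem hasDerivAt_ofReal_mul_exp_angular (r θ : ℝ) :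
    HasDerivAt (fun t : ℝ => (r : ℂ) * Complex.exp (Complex.I * t))
      (Complex.I * (r * Complex.exp (Complex.I * θ))) θ := by
  have h := (((Complex.ofRealCLM.hasDerivAt (x := θ)).const_mul Complex.I).cexp).const_mul (r : ℂ)
  refine h.congr_deriv ?_
  simp
  ring

/-- The sum of two second derivatives along orthonormal directions does not depend on the
directions. -/
theorem bilinear_trace_rotate (B : ℂ →L[ℝ] ℂ →L[ℝ] ℂ) (θ : ℝ) :
    B (Complex.exp (Complex.I * θ)) (Complex.exp (Complex.I * θ))
      + B (Complex.I * Complex.exp (Complex.I * θ)) (Complex.I * Complex.exp (Complex.I * θ))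
      = B 1 1 + B Complex.I Complex.I := by
  have e1 : Complex.exp (Complex.I * θ) = cos θ • (1 : ℂ) + sin θ • Complex.I := by
    rw [exp_I_mul_ofReal]; simp
  have e2 : Complex.I * Complex.exp (Complex.I * θ) = (-sin θ) • (1 : ℂ) + cos θ • Complex.I := by
    rw [exp_I_mul_ofReal, Complex.real_smul, Complex.real_smul, Complex.ofReal_neg]
    linear_combination (sin θ : ℂ) * Complex.I_sq
  rw [e2, e1]
  simp only [map_add, map_smul, add_apply, smul_apply]
  simp only [Complex.real_smul, Complex.ofReal_neg]
  have h : (sin θ : ℂ) ^ 2 + (cos θ : ℂ) ^ 2 = 1 := by exact_mod_cast sin_sq_add_cos_sq θ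
  linear_combination (B 1 1 + B Complex.I Complex.I) * h

/-- The equation `T_α f = 0` in polar coordinates, for the function `Re (c f)`. -/
theorem pde_polar {α : ℝ} {f : ℂ → ℂ} {r : ℝ} (hr : r ∈ Ioo (0 : ℝ) 1) (θ : ℝ)
    (hT : opT α f (r * Complex.exp (Complex.I * θ)) = 0) (c : ℂ) :
    (1 - r ^ 2) * (r ^ 2 * (c * fderiv ℝ (fderiv ℝ f) (r * Complex.exp (Complex.I * θ))
        (Complex.exp (Complex.I * θ)) (Complex.exp (Complex.I * θ))).re
      + r * (c * fderiv ℝ f (r * Complex.exp (Complex.I * θ)) (Complex.exp (Complex.I * θ))).re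
      + (c * (fderiv ℝ (fderiv ℝ f) (r * Complex.exp (Complex.I * θ))
          (Complex.I * (r * Complex.exp (Complex.I * θ)))
          (Complex.I * (r * Complex.exp (Complex.I * θ)))
        + fderiv ℝ f (r * Complex.exp (Complex.I * θ))
          (Complex.I * (Complex.I * (r * Complex.exp (Complex.I * θ)))))).re)
      + 2 * α * r ^ 3 * (c * fderiv ℝ f (r * Complex.exp (Complex.I * θ))
        (Complex.exp (Complex.I * θ))).re
      - α ^ 2 * r ^ 2 * (c * f (r * Complex.exp (Complex.I * θ))).re = 0 := by
  have hr' : r ∈ Ioo (-1 : ℝ) 1 := ⟨by linarith [hr.1], hr.2⟩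
  have hz := ofReal_mul_exp_mem_ball hr' θ
  have h := (opT_eq_zero_iff α f hz).1 hT
  rw [norm_ofReal_mul_exp, sq_abs] at h
  have htr := bilinear_trace_rotate
    (fderiv ℝ (fderiv ℝ f) (r * Complex.exp (Complex.I * θ))) θ
  have hI : Complex.I * (r * Complex.exp (Complex.I * θ))
      = r • (Complex.I * Complex.exp (Complex.I * θ)) := by
    rw [Complex.real_smul]; ring
  have hII : Complex.I * (r • (Complex.I * Complex.exp (Complex.I * θ)))
      = (-r) • Complex.exp (Complex.I * θ) := by
    rw [Complex.real_smul, Complex.real_smul]; push_cast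
    linear_combination (r : ℂ) * Complex.exp (Complex.I * θ) * Complex.I_sq
  rw [hI, hII]
  generalize hD : fderiv ℝ f (r * Complex.exp (Complex.I * θ)) = D at *
  generalize hB : fderiv ℝ (fderiv ℝ f) (r * Complex.exp (Complex.I * θ)) = B at *
  have hDr : D (r * Complex.exp (Complex.I * θ)) = r * D (Complex.exp (Complex.I * θ)) := by
    rw [← Complex.real_smul, map_smul, Complex.real_smul]
  rw [hDr, ← htr] at h
  simp only [map_smul, smul_apply]
  simp only [Complex.real_smul]
  have key : ((1 - r ^ 2 : ℝ) : ℂ) * ((r ^ 2 : ℝ) * (c * B (Complex.exp (Complex.I * θ))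
        (Complex.exp (Complex.I * θ))) + r * (c * D (Complex.exp (Complex.I * θ)))
      + c * (r * (r * B (Complex.I * Complex.exp (Complex.I * θ))
        (Complex.I * Complex.exp (Complex.I * θ)))
        + ((-r : ℝ) : ℂ) * D (Complex.exp (Complex.I * θ))))
      + ((2 * α * r ^ 3 : ℝ) : ℂ) * (c * D (Complex.exp (Complex.I * θ)))
      - ((α ^ 2 * r ^ 2 : ℝ) : ℂ) * (c * f (r * Complex.exp (Complex.I * θ))) = 0 := by
    push_cast at h ⊢
    linear_combination c * r ^ 2 * h
  have := congrArg Complex.re key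
  simpa only [Complex.add_re, Complex.sub_re, Complex.re_ofReal_mul, Complex.zero_re] using this

/-- A solution of `T_α f = 0` gives polar solutions `Re (c f(r e^{iθ}))` for all constants `c`. -/
theorem isPolarSolution_of_opT_eq_zero {α : ℝ} {f : ℂ → ℂ}
    (hf : ContDiffOn ℝ 2 f (Metric.ball (0 : ℂ) 1))
    (hT : ∀ z ∈ Metric.ball (0 : ℂ) 1, opT α f z = 0) (c : ℂ) :
    IsPolarSolution α
      (fun r θ => (c * f (r * Complex.exp (Complex.I * θ))).re)
      (fun r θ => (c * fderiv ℝ f (r * Complex.exp (Complex.I * θ))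
        (Complex.exp (Complex.I * θ))).re)
      (fun r θ => (c * fderiv ℝ (fderiv ℝ f) (r * Complex.exp (Complex.I * θ))
        (Complex.exp (Complex.I * θ)) (Complex.exp (Complex.I * θ))).re)
      (fun r θ => (c * fderiv ℝ f (r * Complex.exp (Complex.I * θ))
        (Complex.I * (r * Complex.exp (Complex.I * θ)))).re)
      (fun r θ => (c * (fderiv ℝ (fderiv ℝ f) (r * Complex.exp (Complex.I * θ))
          (Complex.I * (r * Complex.exp (Complex.I * θ)))
          (Complex.I * (r * Complex.exp (Complex.I * θ)))
        + fderiv ℝ f (r * Complex.exp (Complex.I * θ))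
          (Complex.I * (Complex.I * (r * Complex.exp (Complex.I * θ)))))).re) := by
  have hf1 : ContDiffOn ℝ 1 (fderiv ℝ f) (Metric.ball (0 : ℂ) 1) :=
    hf.fderiv_of_isOpen Metric.isOpen_ball (by norm_num)
  have hf2 : ContinuousOn (fderiv ℝ (fderiv ℝ f)) (Metric.ball (0 : ℂ) 1) :=
    hf1.continuousOn_fderiv_of_isOpen Metric.isOpen_ball le_rfl
  have hd0 : ∀ z ∈ Metric.ball (0 : ℂ) 1, HasFDerivAt f (fderiv ℝ f z) z := fun z hz =>
    ((hf.contDiffAt (Metric.isOpen_ball.mem_nhds hz)).differentiableAt two_ne_zero).hasFDerivAt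
  have hd1 : ∀ z ∈ Metric.ball (0 : ℂ) 1,
      HasFDerivAt (fderiv ℝ f) (fderiv ℝ (fderiv ℝ f) z) z := fun z hz =>
    ((hf1.contDiffAt (Metric.isOpen_ball.mem_nhds hz)).differentiableAt one_ne_zero).hasFDerivAt
  have hmaps : MapsTo (fun p : ℝ × ℝ => (p.1 : ℂ) * Complex.exp (Complex.I * p.2))
      (Ioo (-1) 1 ×ˢ univ) (Metric.ball 0 1) := fun p hp => ofReal_mul_exp_mem_ball hp.1 p.2
  have hpc : ContinuousOn (fun p : ℝ × ℝ => (p.1 : ℂ) * Complex.exp (Complex.I * p.2))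
      (Ioo (-1) 1 ×ˢ univ) := by fun_prop
  have c0 := hf.continuousOn.comp hpc hmaps
  have c1 := hf1.continuousOn.comp hpc hmaps
  have c2 := hf2.comp hpc hmaps
  have hre : ∀ {g : ℝ → ℂ} {g' : ℂ} {x : ℝ}, HasDerivAt g g' x →
      HasDerivAt (fun t => (c * g t).re) (c * g').re x := fun h =>
    Complex.reCLM.hasFDerivAt.comp_hasDerivAt _ (h.const_mul c)
  have hcre : ∀ {g : ℝ × ℝ → ℂ}, ContinuousOn g (Ioo (-1) 1 ×ˢ univ) →
      ContinuousOn (fun p => (c * g p).re) (Ioo (-1) 1 ×ˢ univ) := fun h =>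
    Complex.continuous_re.comp_continuousOn (continuousOn_const.mul h)
  have hexp : ∀ θ : ℝ, Complex.exp (Complex.I * (θ + 2 * π : ℝ)) = Complex.exp (Complex.I * θ) := by
    intro θ
    rw [show Complex.I * ((θ + 2 * π : ℝ) : ℂ) = Complex.I * θ + 2 * π * Complex.I by
      push_cast; ring, Complex.exp_add, Complex.exp_two_pi_mul_I, mul_one]
  have hrad : ∀ r θ : ℝ, HasDerivAt (fun s : ℝ => (s : ℂ) * Complex.exp (Complex.I * θ))
      (Complex.exp (Complex.I * θ)) r := hasDerivAt_ofReal_mul_exp_radial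
  have hang := hasDerivAt_ofReal_mul_exp_angular
  refine ⟨hcre c0, hcre (c1.clm_apply (by fun_prop)),
    hcre ((c2.clm_apply (by fun_prop)).clm_apply (by fun_prop)),
    hcre (c1.clm_apply (by fun_prop)), ?_, fun r hr θ => ?_, fun r hr θ => ?_, fun r hr θ => ?_,
    fun r hr θ => ?_, fun r θ => ?_, fun r θ => ?_, fun r hr θ => ?_⟩
  · exact hcre (((c2.clm_apply (by fun_prop)).clm_apply (by fun_prop)).fun_add
      (c1.clm_apply (by fun_prop)))
  · exact hre ((hd0 _ (ofReal_mul_exp_mem_ball hr θ)).comp_hasDerivAt r (hrad r θ))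
  · have h1 : HasDerivAt (fun s : ℝ => fderiv ℝ f (s * Complex.exp (Complex.I * θ)))
        (fderiv ℝ (fderiv ℝ f) (r * Complex.exp (Complex.I * θ)) (Complex.exp (Complex.I * θ))) r :=
      (hd1 _ (ofReal_mul_exp_mem_ball hr θ)).comp_hasDerivAt r (hrad r θ)
    have h2 := h1.clm_apply (hasDerivAt_const r (Complex.exp (Complex.I * θ)))
    rw [map_zero, add_zero] at h2
    exact hre h2
  · exact hre ((hd0 _ (ofReal_mul_exp_mem_ball hr θ)).comp_hasDerivAt θ (hang r θ))
  · have h1 : HasDerivAt (fun t : ℝ => fderiv ℝ f (r * Complex.exp (Complex.I * t)))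
        (fderiv ℝ (fderiv ℝ f) (r * Complex.exp (Complex.I * θ))
          (Complex.I * (r * Complex.exp (Complex.I * θ)))) θ :=
      (hd1 _ (ofReal_mul_exp_mem_ball hr θ)).comp_hasDerivAt θ (hang r θ)
    exact hre (h1.clm_apply ((hang r θ).const_mul Complex.I))
  · simp only [hexp]
  · simp only [hexp]
  · exact pde_polar hr θ (hT _ (ofReal_mul_exp_mem_ball ⟨by linarith [hr.1], hr.2⟩ θ)) c

/-! ### Two-point estimates and the gradient bound -/

theorem exists_polar (z : ℂ) : ∃ φ : ℝ, (‖z‖ : ℂ) * Complex.exp (Complex.I * φ) = z :=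
  ⟨z.arg, by rw [mul_comm Complex.I]; exact Complex.norm_mul_exp_arg_mul_I z⟩

theorem kernelK_mul_exp_neg (α r φ t : ℝ) :
    kernelK α ((r : ℂ) * Complex.exp (Complex.I * φ) * Complex.exp (-(Complex.I * t)))
      = polarKernel α r (φ - t) := by
  rw [← kernelK_ofReal_mul_exp, mul_assoc, ← Complex.exp_add]
  congr 3; push_cast; ring

theorem norm_mul_exp_neg (z : ℂ) (t : ℝ) : ‖z * Complex.exp (-(Complex.I * t))‖ = ‖z‖ := by
  rw [norm_mul, show -(Complex.I * (t : ℂ)) = ((-t : ℝ) : ℂ) * Complex.I by push_cast; ring,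
    Complex.norm_exp_ofReal_mul_I, mul_one]

theorem continuous_kernelK_mul_exp_neg (α : ℝ) {z : ℂ} (hz : ‖z‖ < 1) :
    Continuous fun t : ℝ => kernelK α (z * Complex.exp (-(Complex.I * t))) := by
  obtain ⟨φ, hφ⟩ := exists_polar z
  rw [← hφ]
  simp only [kernelK_mul_exp_neg]
  have := continuous_slice (isPolarSolution_polarKernel α).cont (r := ‖z‖)
    ⟨by linarith [norm_nonneg z], hz⟩
  fun_prop

theorem integral_kernelK_mul_exp_neg (α : ℝ) (z : ℂ) :
    (1 / (2 * π)) * ∫ t in (0 : ℝ)..(2 * π), kernelK α (z * Complex.exp (-(Complex.I * t)))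
      = meanK α ‖z‖ := by
  obtain ⟨φ, hφ⟩ := exists_polar z
  rw [meanK]
  nth_rewrite 1 [← hφ]
  simp only [kernelK_mul_exp_neg, kernelK_ofReal_mul_exp]
  congr 1
  rw [intervalIntegral.integral_comp_sub_left (polarKernel α ‖z‖), sub_zero]
  have := (periodic_polarKernel α ‖z‖).intervalIntegral_add_eq (φ - 2 * π) 0
  rwa [sub_add_cancel, zero_add] at this

/-- Convolution of a continuous function on the disk, restricted to a circle, with the kernel
`K_α(ρ ·)` recovers the function as `ρ → 1`. -/
theorem tendsto_angularConv_polarKernel {α : ℝ} (hα : -1 < α) {f : ℂ → ℂ}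
    (hf : ContinuousOn f (Metric.ball (0 : ℂ) 1)) (c : ℂ) {r : ℝ} (h0 : 0 ≤ r) (h1 : r < 1)
    (φ : ℝ) :
    Tendsto (fun ρ => angularConv (fun r θ => (c * f (r * Complex.exp (Complex.I * θ))).re)
      (polarKernel α ρ) r φ) (𝓝[<] 1)
      (𝓝 (2 * π * (c * f (r * Complex.exp (Complex.I * φ))).re)) := by
  set H : ℂ → ℝ := fun ζ => (c * f (r * Complex.exp (Complex.I * φ) * (starRingEnd ℂ) ζ)).re with hH
  have hHc : ContinuousOn H (Metric.closedBall 0 1) := by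
    refine Complex.continuous_re.comp_continuousOn (continuousOn_const.mul ?_)
    refine hf.comp (by fun_prop) fun ζ hζ => ?_
    rw [mem_closedBall_zero_iff] at hζ
    rw [mem_ball_zero_iff, norm_mul, norm_ofReal_mul_exp, abs_of_nonneg h0, RCLike.norm_conj]
    nlinarith [norm_nonneg ζ]
  have hHe : ∀ t : ℝ, H (Complex.exp (Complex.I * t))
      = (c * f (r * Complex.exp (Complex.I * (φ - t : ℝ)))).re := by
    intro t
    simp only [hH]
    rw [← Complex.exp_conj, map_mul, Complex.conj_I, Complex.conj_ofReal, mul_assoc,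
      ← Complex.exp_add]
    congr 5; push_cast; ring
  have h := tendsto_integral_polarKernel_mul hHc hα
  have hH1 : H 1 = (c * f (r * Complex.exp (Complex.I * φ))).re := by
    simp only [hH, map_one, mul_one]
  rw [hH1] at h
  refine h.congr fun ρ => ?_
  have hper : Function.Periodic (fun t : ℝ => polarKernel α ρ t * H (Complex.exp (Complex.I * t)))
      (2 * π) := by
    intro t
    simp only [periodic_polarKernel α ρ t]
    rw [show Complex.I * ((t + 2 * π : ℝ) : ℂ) = Complex.I * t + 2 * π * Complex.I by
      push_cast; ring, Complex.exp_add, Complex.exp_two_pi_mul_I, mul_one]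
  have hs := hper.intervalIntegral_add_eq (-π) 0
  rw [zero_add, show -π + 2 * π = π by ring] at hs
  rw [hs, angularConv]
  refine intervalIntegral.integral_congr fun t _ => ?_
  simp only [hHe]
  ring

/-- The consequence of the Poisson representation that is needed here: a linear combination of two
values of a solution bounded by `M` is at most `M` times the `L¹` norm of the same combination of
the kernels. It follows from `IsPolarSolution.conv_swap` by letting the circle on which the
solution is sampled approach the unit circle; no boundary values of `f` are involved. -/
theorem norm_combination_le {α : ℝ} (hα : -1 < α) {f : ℂ → ℂ} {M : ℝ}
    (hf : ContDiffOn ℝ 2 f (Metric.ball (0 : ℂ) 1))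
    (hT : ∀ z ∈ Metric.ball (0 : ℂ) 1, opT α f z = 0)
    (hb : ∀ z ∈ Metric.ball (0 : ℂ) 1, ‖f z‖ ≤ M) (a b : ℝ) {z₁ z₂ : ℂ}
    (hz₁ : ‖z₁‖ < 1) (hz₂ : ‖z₂‖ < 1) :
    ‖(a : ℂ) * f z₁ + (b : ℂ) * f z₂‖ ≤ M * ((1 / (2 * π)) * ∫ t in (0 : ℝ)..(2 * π),
      |a * kernelK α (z₁ * Complex.exp (-(Complex.I * t)))
        + b * kernelK α (z₂ * Complex.exp (-(Complex.I * t)))|) := by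
  obtain ⟨φ₁, hφ₁⟩ := exists_polar z₁
  obtain ⟨φ₂, hφ₂⟩ := exists_polar z₂
  obtain ⟨c, hc1, hc⟩ := RCLike.exists_norm_eq_mul_self ((a : ℂ) * f z₁ + (b : ℂ) * f z₂)
  set u : ℝ → ℝ → ℝ := fun r θ => (c * f (r * Complex.exp (Complex.I * θ))).re with hu
  have hnorm : ‖(a : ℂ) * f z₁ + (b : ℂ) * f z₂‖ = a * u ‖z₁‖ φ₁ + b * u ‖z₂‖ φ₂ := by
    have := congrArg Complex.re hc
    have e : c * ((a : ℂ) * f z₁ + (b : ℂ) * f z₂)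
        = (a : ℂ) * (c * f z₁) + (b : ℂ) * (c * f z₂) := by ring
    rw [e, Complex.add_re, Complex.re_ofReal_mul, Complex.re_ofReal_mul] at this
    simp only [hu, hφ₁, hφ₂]
    rw [← this]
    exact (Complex.ofReal_re _).symm
  have husol := isPolarSolution_of_opT_eq_zero hf hT c
  have hKsol := isPolarSolution_polarKernel α
  have hr₁ : ‖z₁‖ ∈ Ioo (-1 : ℝ) 1 := ⟨by linarith [norm_nonneg z₁], hz₁⟩
  have hr₂ : ‖z₂‖ ∈ Ioo (-1 : ℝ) 1 := ⟨by linarith [norm_nonneg z₂], hz₂⟩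
  have hlim := ((tendsto_angularConv_polarKernel hα hf.continuousOn c (norm_nonneg z₁) hz₁
    φ₁).const_mul a).add ((tendsto_angularConv_polarKernel hα hf.continuousOn c (norm_nonneg z₂)
    hz₂ φ₂).const_mul b)
  have hk₁ : Continuous fun t => polarKernel α ‖z₁‖ (φ₁ - t) := by
    have := continuous_slice hKsol.cont hr₁
    fun_prop
  have hk₂ : Continuous fun t => polarKernel α ‖z₂‖ (φ₂ - t) := by
    have := continuous_slice hKsol.cont hr₂
    fun_prop
  have hmain : a * (2 * π * u ‖z₁‖ φ₁) + b * (2 * π * u ‖z₂‖ φ₂)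
      ≤ ∫ t in (0 : ℝ)..(2 * π), M * |a * polarKernel α ‖z₁‖ (φ₁ - t)
        + b * polarKernel α ‖z₂‖ (φ₂ - t)| := by
    refine le_of_tendsto hlim ?_
    filter_upwards [Ioo_mem_nhdsLT (max_lt hz₁ hz₂)] with ρ hρ
    have h1 : ‖z₁‖ ≤ ρ := (le_max_left _ _).trans hρ.1.le
    have h2 : ‖z₂‖ ≤ ρ := (le_max_right _ _).trans hρ.1.le
    have hρ' : ρ ∈ Ioo (-1 : ℝ) 1 := ⟨by linarith [hr₁.1], hρ.2⟩
    rw [husol.conv_swap hKsol (norm_nonneg z₁) h1 hρ.2,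
      husol.conv_swap hKsol (norm_nonneg z₂) h2 hρ.2]
    have hcu := continuous_slice husol.cont hρ'
    simp only [angularConv]
    rw [← intervalIntegral.integral_const_mul, ← intervalIntegral.integral_const_mul,
      ← intervalIntegral.integral_add (Continuous.intervalIntegrable (by fun_prop) _ _)
        (Continuous.intervalIntegrable (by fun_prop) _ _)]
    refine intervalIntegral.integral_mono_on two_pi_pos.le
      (Continuous.intervalIntegrable (by fun_prop) _ _)
      (Continuous.intervalIntegrable (by fun_prop) _ _) fun t _ => ?_
    have hM : |(c * f (ρ * Complex.exp (Complex.I * t))).re| ≤ M := by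
      refine (Complex.abs_re_le_norm _).trans ?_
      rw [norm_mul, hc1, one_mul]
      exact hb _ (ofReal_mul_exp_mem_ball hρ' t)
    calc _ = (c * f (ρ * Complex.exp (Complex.I * t))).re
          * (a * polarKernel α ‖z₁‖ (φ₁ - t) + b * polarKernel α ‖z₂‖ (φ₂ - t)) := by ring
      _ ≤ |(c * f (ρ * Complex.exp (Complex.I * t))).re|
          * |a * polarKernel α ‖z₁‖ (φ₁ - t) + b * polarKernel α ‖z₂‖ (φ₂ - t)| := by
        rw [← abs_mul]; exact le_abs_self _
      _ ≤ _ := by gcongr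
  rw [intervalIntegral.integral_const_mul] at hmain
  have e : ∀ t : ℝ, |a * kernelK α (z₁ * Complex.exp (-(Complex.I * t)))
      + b * kernelK α (z₂ * Complex.exp (-(Complex.I * t)))|
      = |a * polarKernel α ‖z₁‖ (φ₁ - t) + b * polarKernel α ‖z₂‖ (φ₂ - t)| := by
    intro t
    rw [← kernelK_mul_exp_neg, ← kernelK_mul_exp_neg, hφ₁, hφ₂]
  simp only [e]
  rw [hnorm, ← mul_assoc, mul_comm M, mul_assoc, one_div, ← div_eq_inv_mul, le_div_iff₀ two_pi_pos]
  linarith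

theorem kernelK_pos {α : ℝ} (hα : -1 < α) {z : ℂ} (hz : ‖z‖ < 1) : 0 < kernelK α z := by
  have hw : 0 < 1 - ‖z‖ ^ 2 := by nlinarith [norm_nonneg z]
  have h1 : 0 < ‖1 - z‖ := by
    have := norm_sub_norm_le (1 : ℂ) z
    rw [norm_one] at this
    linarith
  have := kernelConst_pos hα
  unfold kernelK
  positivity

theorem kernelK_zero (α : ℝ) : kernelK α 0 = kernelConst α := by
  simp [kernelK]

/-- Harnack's inequality for the kernel; equality holds at `z = -‖z‖`. -/
theorem mul_kernelK_zero_le {α : ℝ} (hα : -1 < α) {z : ℂ} (hz : ‖z‖ < 1) :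
    (1 - ‖z‖) ^ (α + 1) / (1 + ‖z‖) * kernelK α 0 ≤ kernelK α z := by
  have hn := norm_nonneg z
  have hw : 0 < 1 - ‖z‖ ^ 2 := by nlinarith
  have h1 : 0 < ‖1 - z‖ := by
    have := norm_sub_norm_le (1 : ℂ) z
    rw [norm_one] at this
    linarith
  have h2 : ‖1 - z‖ ≤ 1 + ‖z‖ := by simpa using norm_sub_le (1 : ℂ) z
  have hk := kernelConst_pos hα
  rw [kernelK_zero, kernelK, mul_comm]
  refine mul_le_mul_of_nonneg_left ?_ hk.le
  have e : (1 - ‖z‖) ^ (α + 1) / (1 + ‖z‖) = (1 - ‖z‖ ^ 2) ^ (α + 1) / (1 + ‖z‖) ^ (α + 2) := by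
    rw [show 1 - ‖z‖ ^ 2 = (1 - ‖z‖) * (1 + ‖z‖) by ring, mul_rpow (by linarith) (by linarith),
      show α + 2 = α + 1 + 1 by ring, rpow_add_one (by positivity) (α + 1)]
    field_simp
  rw [e]
  exact div_le_div_of_nonneg_left (rpow_nonneg hw.le _) (rpow_pos_of_pos h1 _)
    (rpow_le_rpow h1.le h2 (by linarith))

/-- A Lipschitz constant of `log K_α` on the disk `‖z‖ ≤ R`. -/
noncomputable def logKernelLipschitz (α R : ℝ) : ℝ := (2 + α + (4 + 3 * α) * R) / (1 - R ^ 2)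

/-- `log K_α` is Lipschitz on `‖z‖ ≤ R`: the numerator `(1 - ‖z‖²) ^ (α + 1)` contributes
`2 (α + 1) R / (1 - R²)` and the denominator `‖1 - z‖ ^ (α + 2)` contributes
`(α + 2) / (1 - R)`. -/
theorem kernelK_le_exp_mul {α : ℝ} (hα : -1 < α) {R : ℝ} (hR : R < 1) {z w : ℂ} (hz : ‖z‖ ≤ R)
    (hw : ‖w‖ ≤ R) : kernelK α w ≤ exp (logKernelLipschitz α R * ‖w - z‖) * kernelK α z := by
  have hR0 : 0 ≤ R := (norm_nonneg z).trans hz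
  set s := ‖w - z‖ with hs
  have hs0 : 0 ≤ s := norm_nonneg _
  have hRR : 0 < 1 - R ^ 2 := by nlinarith
  have hwz : ∀ {v : ℂ}, ‖v‖ ≤ R → 1 - R ^ 2 ≤ 1 - ‖v‖ ^ 2 := fun {v} hv => by
    have := norm_nonneg v
    nlinarith
  have hdist : ∀ {v : ℂ}, ‖v‖ ≤ R → 1 - R ≤ ‖1 - v‖ := fun {v} hv => by
    have := norm_sub_norm_le (1 : ℂ) v
    rw [norm_one] at this
    linarith
  have hR1 : 0 < 1 - R := by linarith
  have hz2 := hwz hz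
  have hw2 := hwz hw
  have hnum : 1 - ‖w‖ ^ 2 ≤ (1 - ‖z‖ ^ 2) * exp (2 * R / (1 - R ^ 2) * s) := by
    have h1 : ‖z‖ ≤ ‖w‖ + s := by
      rw [hs, norm_sub_rev]
      linarith [norm_sub_norm_le z w]
    have h2 : 1 - ‖w‖ ^ 2 ≤ (1 - ‖z‖ ^ 2) + 2 * R * s := by
      nlinarith [norm_nonneg z, norm_nonneg w]
    have h3 : 2 * R * s ≤ (1 - ‖z‖ ^ 2) * (2 * R / (1 - R ^ 2) * s) := by
      calc 2 * R * s = (1 - R ^ 2) * (2 * R / (1 - R ^ 2) * s) := by field_simp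
        _ ≤ _ := mul_le_mul_of_nonneg_right hz2 (by positivity)
    have h4 := add_one_le_exp (2 * R / (1 - R ^ 2) * s)
    nlinarith
  have hden : ‖1 - z‖ ≤ ‖1 - w‖ * exp (1 / (1 - R) * s) := by
    have h2 : ‖1 - z‖ ≤ ‖1 - w‖ + s := by
      have := norm_add_le (1 - w) (w - z)
      rwa [sub_add_sub_cancel] at this
    have h3 : s ≤ ‖1 - w‖ * (1 / (1 - R) * s) := by
      calc s = (1 - R) * (1 / (1 - R) * s) := by field_simp
        _ ≤ _ := mul_le_mul_of_nonneg_right (hdist hw) (by positivity)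
    have h4 := add_one_le_exp (1 / (1 - R) * s)
    nlinarith [norm_nonneg (1 - w)]
  have hzp : 0 < ‖1 - z‖ := hR1.trans_le (hdist hz)
  have hwp : 0 < ‖1 - w‖ := hR1.trans_le (hdist hw)
  have hk := kernelConst_pos hα
  have hexp : exp (logKernelLipschitz α R * s)
      = exp (2 * R / (1 - R ^ 2) * s) ^ (α + 1) * exp (1 / (1 - R) * s) ^ (α + 2) := by
    rw [← exp_mul, ← exp_mul, ← exp_add, logKernelLipschitz]
    congr 1
    have : 1 + R ≠ 0 := by positivity
    rw [show 1 - R ^ 2 = (1 - R) * (1 + R) by ring]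
    field_simp
    ring
  rw [kernelK, kernelK, mul_left_comm]
  refine mul_le_mul_of_nonneg_left ?_ hk.le
  rw [hexp, mul_div_assoc', div_le_div_iff₀ (rpow_pos_of_pos hwp _) (rpow_pos_of_pos hzp _)]
  calc (1 - ‖w‖ ^ 2) ^ (α + 1) * ‖1 - z‖ ^ (α + 2)
      ≤ ((1 - ‖z‖ ^ 2) * exp (2 * R / (1 - R ^ 2) * s)) ^ (α + 1)
        * (‖1 - w‖ * exp (1 / (1 - R) * s)) ^ (α + 2) := by
        refine mul_le_mul (rpow_le_rpow (by linarith) hnum (by linarith))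
          (rpow_le_rpow hzp.le hden (by linarith)) (by positivity) (rpow_nonneg ?_ _)
        have : 0 ≤ 1 - ‖z‖ ^ 2 := by linarith
        positivity
    _ = _ := by
        rw [mul_rpow (by linarith) (exp_pos _).le, mul_rpow hwp.le (exp_pos _).le]
        ring

theorem abs_kernelK_sub_le {α : ℝ} (hα : -1 < α) {R : ℝ} (hR : R < 1) {z w : ℂ} (hz : ‖z‖ ≤ R)
    (hw : ‖w‖ ≤ R) :
    |kernelK α w - kernelK α z| ≤ (exp (logKernelLipschitz α R * ‖w - z‖) - 1) * kernelK α z := by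
  have h1 := kernelK_le_exp_mul hα hR hz hw
  have h2 := kernelK_le_exp_mul hα hR hw hz
  rw [norm_sub_rev] at h2
  set E := exp (logKernelLipschitz α R * ‖w - z‖)
  have hE : 0 < E := exp_pos _
  have hz0 := kernelK_pos hα (hz.trans_lt hR)
  rw [abs_le]
  constructor
  · have h3 : kernelK α z / E ≤ kernelK α w := by rwa [div_le_iff₀' hE]
    have h4 : kernelK α z * (2 - E) ≤ kernelK α z / E := by
      rw [le_div_iff₀ hE, mul_assoc]
      exact mul_le_of_le_one_right hz0.le (by nlinarith [sq_nonneg (E - 1)])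
    linarith
  · linarith

/-- The difference estimate that gives the gradient bound in the limit `w → z`. -/
theorem norm_sub_le_of_opT_eq_zero {α : ℝ} (hα : -1 < α) {f : ℂ → ℂ} {M : ℝ} (hM : 0 < M)
    (hf : ContDiffOn ℝ 2 f (Metric.ball (0 : ℂ) 1))
    (hT : ∀ z ∈ Metric.ball (0 : ℂ) 1, opT α f z = 0)
    (hb : ∀ z ∈ Metric.ball (0 : ℂ) 1, ‖f z‖ ≤ M) {R : ℝ} (hR : R < 1) {z w : ℂ} (hz : ‖z‖ ≤ R)
    (hw : ‖w‖ ≤ R) :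
    ‖f w - f z‖ ≤ M * meanK α ‖z‖ * (exp (logKernelLipschitz α R * ‖w - z‖) - 1) := by
  have h := norm_combination_le hα hf hT hb 1 (-1) (hw.trans_lt hR) (hz.trans_lt hR)
  simp only [Complex.ofReal_one, one_mul, Complex.ofReal_neg, neg_one_mul, ← sub_eq_add_neg] at h
  refine h.trans ?_
  rw [← integral_kernelK_mul_exp_neg, mul_assoc M]
  refine mul_le_mul_of_nonneg_left ?_ hM.le
  rw [mul_assoc, ← intervalIntegral.integral_mul_const]
  refine mul_le_mul_of_nonneg_left ?_ (by positivity)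
  have c1 := continuous_kernelK_mul_exp_neg α (hw.trans_lt hR)
  have c2 := continuous_kernelK_mul_exp_neg α (hz.trans_lt hR)
  refine intervalIntegral.integral_mono_on two_pi_pos.le
    (Continuous.intervalIntegrable (by fun_prop) _ _)
    (Continuous.intervalIntegrable (by fun_prop) _ _) fun t _ => ?_
  have h3 := abs_kernelK_sub_le hα hR (z := z * Complex.exp (-(Complex.I * t)))
    (w := w * Complex.exp (-(Complex.I * t))) (by rwa [norm_mul_exp_neg])
    (by rwa [norm_mul_exp_neg])
  rw [← sub_mul, norm_mul_exp_neg] at h3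
  exact h3.trans_eq (mul_comm _ _)

theorem meanK_nonneg {α : ℝ} (hα : -1 < α) {r : ℝ} (h0 : 0 ≤ r) (h1 : r < 1) : 0 ≤ meanK α r := by
  have hk := (kernelConst_pos hα).le
  exact (hasSum_meanK α h0 h1).nonneg fun n => by positivity

theorem logKernelLipschitz_nonneg {α : ℝ} (hα : -1 < α) {R : ℝ} (h0 : 0 ≤ R) (h1 : R < 1) :
    0 ≤ logKernelLipschitz α R := by
  refine div_nonneg ?_ (by nlinarith)
  nlinarith

theorem norm_fderiv_le_of_opT_eq_zero {α : ℝ} (hα : -1 < α) {f : ℂ → ℂ} {M : ℝ} (hM : 0 < M)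
    (hf : ContDiffOn ℝ 2 f (Metric.ball (0 : ℂ) 1))
    (hT : ∀ z ∈ Metric.ball (0 : ℂ) 1, opT α f z = 0)
    (hb : ∀ z ∈ Metric.ball (0 : ℂ) 1, ‖f z‖ ≤ M) {z : ℂ} (hz : ‖z‖ < 1) :
    ‖fderiv ℝ f z‖ ≤ M * meanK α ‖z‖ * logKernelLipschitz α ‖z‖ := by
  have hn := norm_nonneg z
  have hm := meanK_nonneg hα hn hz
  have hbound : ∀ δ ∈ Ioo 0 (1 - ‖z‖), ‖fderiv ℝ f z‖ ≤ M * meanK α ‖z‖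
      * (logKernelLipschitz α (‖z‖ + δ) * exp (logKernelLipschitz α (‖z‖ + δ) * δ)) := by
    intro δ hδ
    have hδ0 := hδ.1
    have hR : ‖z‖ + δ < 1 := by linarith [hδ.2]
    have hL := logKernelLipschitz_nonneg hα (R := ‖z‖ + δ) (by linarith) hR
    refine norm_fderiv_le_of_lip' ℝ (by positivity) ?_
    filter_upwards [Metric.closedBall_mem_nhds z hδ0] with w hw
    rw [mem_closedBall_iff_norm] at hw
    have hwn : ‖w‖ ≤ ‖z‖ + δ := by
      have := norm_sub_norm_le w z
      linarith
    refine (norm_sub_le_of_opT_eq_zero hα hM hf hT hb hR (z := z) (by linarith) hwn).trans ?_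
    rw [mul_assoc (M * _)]
    refine mul_le_mul_of_nonneg_left ?_ (by positivity)
    set L := logKernelLipschitz α (‖z‖ + δ)
    -- Convexity of the exponential: `e^x - 1 ≤ x e^x`.
    have h1 : exp (L * ‖w - z‖) - 1 ≤ L * ‖w - z‖ * exp (L * ‖w - z‖) := by
      have h := mul_le_mul_of_nonneg_right (add_one_le_exp (-(L * ‖w - z‖)))
        (exp_pos (L * ‖w - z‖)).le
      rw [← exp_add, neg_add_cancel, exp_zero] at h
      linarith
    refine h1.trans ?_
    calc L * ‖w - z‖ * exp (L * ‖w - z‖) ≤ L * ‖w - z‖ * exp (L * δ) := by gcongr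
      _ = _ := by ring
  have hcont : ContinuousAt (fun δ : ℝ => M * meanK α ‖z‖
      * (logKernelLipschitz α (‖z‖ + δ) * exp (logKernelLipschitz α (‖z‖ + δ) * δ))) 0 := by
    have hL : ContinuousAt (fun δ : ℝ => logKernelLipschitz α (‖z‖ + δ)) 0 := by
      unfold logKernelLipschitz
      refine ContinuousAt.div (by fun_prop) (by fun_prop) ?_
      rw [add_zero]
      nlinarith
    fun_prop
  have hlim : Tendsto _ (𝓝[>] (0 : ℝ)) _ := hcont.tendsto.mono_left nhdsWithin_le_nhds
  simp only [add_zero, mul_zero, exp_zero, mul_one] at hlim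
  refine ge_of_tendsto hlim ?_
  filter_upwards [Ioo_mem_nhdsGT (sub_pos.2 hz)] with δ hδ using hbound δ hδ

theorem theorem1 (α : ℝ) (hα : -1 < α) (f : ℂ → ℂ) (M : ℝ) (hM : 0 < M)
    (hf : ContDiffOn ℝ 2 f (Metric.ball (0 : ℂ) 1))
    (hT : ∀ z ∈ Metric.ball (0 : ℂ) 1, opT α f z = 0)
    (hb : ∀ z ∈ Metric.ball (0 : ℂ) 1, ‖f z‖ ≤ M) :
    (∀ r ∈ Set.Ico (0 : ℝ) 1,
      meanK α r = Real.Gamma (1 + α / 2) ^ 2 / Real.Gamma (1 + α)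
        * ordinaryHypergeometric (-(α / 2)) (-(α / 2)) (1 : ℝ) (r ^ 2)) ∧
    ∀ z ∈ Metric.ball (0 : ℂ) 1,
      ‖f z - (((1 - ‖z‖) ^ (α + 1) / (1 + ‖z‖) : ℝ) : ℂ) * f 0‖
          ≤ M * ((1 / (2 * Real.pi)) * (∫ t in (0 : ℝ)..(2 * Real.pi),
                kernelK α (z * Complex.exp (-(Complex.I * (t : ℂ)))))
              - (1 - ‖z‖) ^ (α + 1) / (1 + ‖z‖) * kernelK α 0) ∧
      ‖fderiv ℝ f z‖
          ≤ M * meanK α ‖z‖ * (2 + α + (4 + 3 * α) * ‖z‖) / (1 - ‖z‖ ^ 2) ∧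
      M * meanK α ‖z‖ * (2 + α + (4 + 3 * α) * ‖z‖) / (1 - ‖z‖ ^ 2)
          ≤ M * (2 + α + (4 + 3 * α) * ‖z‖) / (1 - ‖z‖ ^ 2) := by
  refine ⟨fun r hr => meanK_eq_hypergeometric α hr.1 hr.2, fun z hz => ?_⟩
  have hz1 : ‖z‖ < 1 := by simpa using hz
  have hn := norm_nonneg z
  refine ⟨?_, ?_, ?_⟩
  · set q : ℝ := (1 - ‖z‖) ^ (α + 1) / (1 + ‖z‖) with hq
    have h := norm_combination_le hα hf hT hb 1 (-q) hz1 (z₂ := 0) (by simp)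
    rw [Complex.ofReal_one, one_mul, Complex.ofReal_neg, neg_mul, ← sub_eq_add_neg] at h
    refine h.trans_eq ?_
    have hc := continuous_kernelK_mul_exp_neg α hz1
    have e : ∀ t : ℝ, |1 * kernelK α (z * Complex.exp (-(Complex.I * t)))
        + -q * kernelK α (0 * Complex.exp (-(Complex.I * t)))|
        = kernelK α (z * Complex.exp (-(Complex.I * t))) - q * kernelK α 0 := by
      intro t
      have hk := mul_kernelK_zero_le hα (z := z * Complex.exp (-(Complex.I * t)))
        (by rwa [norm_mul_exp_neg])
      rw [norm_mul_exp_neg, ← hq] at hk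
      rw [zero_mul, one_mul, neg_mul, ← sub_eq_add_neg, abs_of_nonneg (sub_nonneg.2 hk)]
    simp only [e]
    rw [intervalIntegral.integral_sub (hc.intervalIntegrable _ _) intervalIntegrable_const,
      intervalIntegral.integral_const, smul_eq_mul, sub_zero]
    have := pi_pos.ne'
    field_simp
  · have h := norm_fderiv_le_of_opT_eq_zero hα hM hf hT hb hz1
    rwa [logKernelLipschitz, ← mul_div_assoc] at h
  · have h := logKernelLipschitz_nonneg hα hn hz1
    rw [logKernelLipschitz] at h
    rw [mul_div_assoc, mul_div_assoc]
    refine mul_le_mul_of_nonneg_right ?_ h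
    exact mul_le_of_le_one_right hM.le (meanK_le_one hα hn hz1)
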